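/- Let $\eta$ be a Poisson point process of intensity $1$ in the plane $\mathbb{R}^2$ and, for $u \in \eta$, let $C(u) = \{x \in \mathbb{R}^2 : \|u-x\|_2 \le \|v-x\|_2 \text{ for every } v \in \eta\}$ be its Voronoi cell. Given $\eta$, let $\omega \colon \eta \to \{\text{red},\text{blue}\}$ be a uniformly random two-colouring, i.e. the colours of the points are independent and each is red or blue with probability $1/2$; write $\mathbb{P}(\,\cdot \mid \eta)$ and $\mathbb{E}[\,\cdot \mid \eta]$ for probability and expectation with respect to this random colouring of the given set $\eta$. Let $R = [x_0,x_1]\times[y_0,y_1]$ with $x_0<x_1$ and $y_0<y_1$. Let $H_R$ be the event that there is a continuous path in $R$ from the left-hand to the right-hand side of $R$ that intersects only red cells. Let $X = X(\eta,\omega)$ be the maximal number of vertex-disjoint monochromatic vertical crossings of $R$: a monochromatic vertical crossing is a continuous path in $R$ from the bottom to the top side of $R$ such that all cells that it intersects have the same colour (different crossings may have different colours), and crossings are vertex-disjoint if no two of them intersect a common cell. Then, for almost every $\eta$, the event $H_R$ and the random variable $X$ are measurable with respect to the product $\sigma$-algebra on the colourings of $\eta$, the maximum defining $X$ exists for every colouring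 $\omega$, and $$\mathbb{P}\big(H_R \mid \eta\big) = \mathbb{E}\big[2^{-X} \mid \eta\big].$$ -/

import Mathlib

open MeasureTheory ProbabilityTheory

namespace Voronoi

/-- The Euclidean plane. -/
abbrev Plane : Type := EuclideanSpace ℝ (Fin 2)

/-- `η` is a homogeneous Poisson point process of intensity `1` in the plane (as a random set of
points): the number of points in a Borel set `A` of finite area is a Poisson random variable whose
mean is the area of `A`, and the numbers of points in finitely many pairwise disjoint such sets
are independent. -/
structure IsPoissonProcess {Ω : Type*} [MeasurableSpace Ω] (P : Measure Ω)
    (η : Ω → Set Plane) : Prop where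
  measurable_count : ∀ A : Set Plane, MeasurableSet A → volume A < ⊤ →
    Measurable fun w => (η w ∩ A).encard
  law_count : ∀ A : Set Plane, MeasurableSet A → volume A < ⊤ →
    P.map (fun w => (η w ∩ A).encard) =
      (poissonMeasure (volume A).toNNReal).map (fun k : ℕ => (k : ℕ∞))
  indep_count : ∀ (n : ℕ) (A : Fin n → Set Plane),
    (∀ i, MeasurableSet (A i)) → (∀ i, volume (A i) < ⊤) →
    Pairwise (fun i j => Disjoint (A i) (A j)) →
    iIndepFun (fun i w => (η w ∩ A i).encard) P

/-- The Voronoi cell of the point `u` with respect to the point set `η`. -/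
def cell (η : Set Plane) (u : Plane) : Set Plane :=
  {x | ∀ v ∈ η, ‖u - x‖ ≤ ‖v - x‖}

/-- A two-colouring of the points of `η`; `true` is red and `false` is blue. -/
abbrev Colouring (η : Set Plane) : Type := η → Bool

/-- The law of the uniformly random two-colouring of a given point set `η`: the colours of
distinct points are independent and each is red or blue with probability `1/2`. This is the
conditional law of the colouring given `η`. -/
noncomputable def colourLaw (η : Set Plane) : Measure (Colouring η) :=
  Measure.infinitePi fun _ : η => (PMF.uniformOfFintype Bool).toMeasure

/-- The rectangle `[x₀, x₁] × [y₀, y₁]`. -/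
def rect (x₀ x₁ y₀ y₁ : ℝ) : Set Plane :=
  {p | p 0 ∈ Set.Icc x₀ x₁ ∧ p 1 ∈ Set.Icc y₀ y₁}

/-- A continuous path in `[x₀, x₁] × [y₀, y₁]` from the left-hand to the right-hand side. -/
def IsHorizontalCrossing (x₀ x₁ y₀ y₁ : ℝ) (γ : C(unitInterval, Plane)) : Prop :=
  (∀ t, γ t ∈ rect x₀ x₁ y₀ y₁) ∧ γ 0 0 = x₀ ∧ γ 1 0 = x₁

/-- A continuous path in `[x₀, x₁] × [y₀, y₁]` from the bottom to the top side. -/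
def IsVerticalCrossing (x₀ x₁ y₀ y₁ : ℝ) (γ : C(unitInterval, Plane)) : Prop :=
  (∀ t, γ t ∈ rect x₀ x₁ y₀ y₁) ∧ γ 0 1 = y₀ ∧ γ 1 1 = y₁

/-- The path `γ` intersects (or touches) the Voronoi cell of `u`. -/
def Meets (η : Set Plane) (γ : C(unitInterval, Plane)) (u : η) : Prop :=
  ∃ t, γ t ∈ cell η u

/-- The path `γ` only intersects cells of colour `col`. -/
def HasColour (η : Set Plane) (ω : Colouring η) (col : Bool) (γ : C(unitInterval, Plane)) : Prop :=
  ∀ u : η, Meets η γ u → ω u = col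

/-- All cells intersected by the path `γ` have the same colour. -/
def IsMonochromatic (η : Set Plane) (ω : Colouring η) (γ : C(unitInterval, Plane)) : Prop :=
  ∃ col, HasColour η ω col γ

/-- The event `H_R`, `R = [x₀, x₁] × [y₀, y₁]`: the colourings of `η` for which there is a red
horizontal crossing of `R`. -/
def redCrossing (η : Set Plane) (x₀ x₁ y₀ y₁ : ℝ) : Set (Colouring η) :=
  {ω | ∃ γ, IsHorizontalCrossing x₀ x₁ y₀ y₁ γ ∧ HasColour η ω true γ}

/-- The set of `m` for which there are `m` vertex-disjoint monochromatic vertical crossings of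
`[x₀, x₁] × [y₀, y₁]`, where vertex-disjoint means that no two of them intersect a common cell. -/
def crossingCounts (η : Set Plane) (ω : Colouring η) (x₀ x₁ y₀ y₁ : ℝ) : Set ℕ :=
  {m | ∃ γ : Fin m → C(unitInterval, Plane),
    (∀ i, IsVerticalCrossing x₀ x₁ y₀ y₁ (γ i) ∧ IsMonochromatic η ω (γ i)) ∧
    ∀ i j, i ≠ j → ∀ u : η, ¬ (Meets η (γ i) u ∧ Meets η (γ j) u)}

/-- `X(η, ω)`: the maximal number of vertex-disjoint monochromatic vertical crossings. -/
noncomputable def maxCrossings (η : Set Plane) (x₀ x₁ y₀ y₁ : ℝ) (ω : Colouring η) : ℕ :=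
  sSup (crossingCounts η ω x₀ x₁ y₀ y₁)

end Voronoi

/-! Only the finitely many cells meeting the rectangle matter. By planar duality a red horizontal
crossing exists exactly when no blue vertical crossing does, so the claim is that the latter has
probability $\mathbb{E}[2^{-X}]$.

This is colour switching. Among the monochromatic vertical crossings there is a leftmost one, `γ`.
Whether `γ` is leftmost does not depend on the colours strictly to its right, and it stays leftmost
when all colours not to its right are swapped. Hence, given that part up to the swap, `γ` is red or
blue with probability 1/2 each, independently of what lies to the right. Taking `γ` and continuing
to its right is an optimal greedy choice, so `X` drops by exactly one. The `X` crossings found in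
this way have independent fair colours, and there is no blue crossing exactly when all of them are
red. `Lawful.sum_noCol` turns this into an induction; its weight `g` carries the conditioning on the
explored part.

The combinatorics uses only the four laws in `Lawful`. For Voronoi cells they follow from local
finiteness and two planar facts, proved with continuous logarithms: horizontal and vertical
crossings meet (`exists_eq_of_crossings`), and a vertical crossing exists unless it is blocked
(`exists_vertical_avoiding`). General position is needed to turn a chain of red cells into a red
path, because a path through a point common to several cells meets all of them. It holds almost
surely since tuples of points of the process avoid closed null sets (`IsPoissonProcess.ae_notMem`).
-/

namespace Voronoi

/-! ### Crossing systems and the left-to-right order of crossings -/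

/-- A finite combinatorial model of crossings: a relation `r` on cells, sets of cells touching the
left and the right side, and a family `C` of sets of cells, those of the vertical crossings, such
that a set of cells contains a member of `C` if and only if its complement contains no `r`-chain
from left to right. -/
structure CrossingSystem (V : Type*) where
  r : V → V → Prop
  left : Set V
  right : Set V
  C : Set (Set V)

namespace CrossingSystem

variable {V : Type*} (G : CrossingSystem V)

/-- `G.Reach T v`: there is an `r`-chain within `T` from `v` to the right side. -/
inductive Reach (T : Set V) : V → Prop
  | base {v : V} : v ∈ T → v ∈ G.right → Reach T v
  | step {v w : V} : v ∈ T → G.r v w → Reach T w → Reach T v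

/-- The cells connected to the right side in the complement of `δ`. -/
def rightOf (δ : Set V) : Set V := {v | G.Reach δᶜ v}

/-- The laws of a crossing system. -/
structure Lawful : Prop where
  nonempty : ∀ δ ∈ G.C, δ.Nonempty
  -- Connectedness of `δ` along `r`, phrased through invariant sets so that no chains inside `δ`
  -- need to be built.
  conn : ∀ δ ∈ G.C, ∀ U : Set V, (∃ v ∈ δ, v ∈ U) →
    (∀ v ∈ δ, ∀ w ∈ δ, G.r w v → v ∈ U → w ∈ U) → δ ⊆ U
  blocks : ∀ δ ∈ G.C, ∀ v ∈ G.left, ¬ G.Reach δᶜ v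
  exists_of_blocks : ∀ S : Set V, (∀ v ∈ G.left, ¬ G.Reach Sᶜ v) → ∃ δ ∈ G.C, δ ⊆ S

variable {G}

lemma Reach.mem {T : Set V} {v : V} (h : G.Reach T v) : v ∈ T := by cases h <;> assumption

lemma disjoint_rightOf (δ : Set V) : Disjoint δ (G.rightOf δ) :=
  Set.disjoint_left.2 fun _ hv h => h.mem hv

/-- Every cell of a chain witnessing membership in `G.rightOf δ'` is itself in `G.rightOf δ'`, so
the chain avoids `δ`. -/
lemma rightOf_mono {δ δ' : Set V} (h : Disjoint δ (G.rightOf δ')) :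
    G.rightOf δ' ⊆ G.rightOf δ := by
  intro v hv
  change G.Reach δᶜ v
  induction (show G.Reach δ'ᶜ v from hv) with
  | base hT hr => exact .base (fun hd => Set.disjoint_left.1 h hd (Reach.base hT hr)) hr
  | step hT hr hw ih =>
    exact .step (fun hd => Set.disjoint_left.1 h hd (Reach.step hT hr hw)) hr (ih hw)

/-- The left envelope of two crossings. The cells of `δ₁ ∪ δ₂` lying to the right of neither still
block: a chain to the right side that avoids them stays in `G.rightOf δ₁ ∪ G.rightOf δ₂`, which
contains no left cell. -/
lemma Lawful.exists_meet (hG : G.Lawful) {δ₁ δ₂ : Set V} (h₁ : δ₁ ∈ G.C) (h₂ : δ₂ ∈ G.C) :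
    ∃ δ ∈ G.C, δ ⊆ δ₁ ∪ δ₂ ∧ Disjoint δ (G.rightOf δ₁) ∧ Disjoint δ (G.rightOf δ₂) := by
  obtain ⟨δ, hδ, hs⟩ := hG.exists_of_blocks
    {v | v ∈ δ₁ ∪ δ₂ ∧ v ∉ G.rightOf δ₁ ∧ v ∉ G.rightOf δ₂} (by
      intro v hv hreach
      have key : v ∈ G.rightOf δ₁ ∨ v ∈ G.rightOf δ₂ := by
        clear hv
        induction hreach with
        | @base v hT hr =>
          by_cases hv : v ∈ δ₁ ∪ δ₂
          · by_contra hcon; push Not at hcon; exact hT ⟨hv, hcon⟩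
          · exact Or.inl (.base (fun h => hv (Or.inl h)) hr)
        | @step v w hT hr hw ih =>
          by_cases hv : v ∈ δ₁ ∪ δ₂
          · by_contra hcon; push Not at hcon; exact hT ⟨hv, hcon⟩
          · exact ih.imp (fun h => Reach.step (fun h => hv (Or.inl h)) hr h)
              (fun h => Reach.step (fun h => hv (Or.inr h)) hr h)
      exact key.elim (hG.blocks _ h₁ v hv) (hG.blocks _ h₂ v hv))
  exact ⟨δ, hδ, fun v hv => (hs hv).1, Set.disjoint_left.2 fun v hv => (hs hv).2.1,
    Set.disjoint_left.2 fun v hv => (hs hv).2.2⟩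

/-- A connected set disjoint from `δ₂` cannot lie on both sides of it. -/
lemma Lawful.subset_rightOf_or (hG : G.Lawful) {δ₁ δ₂ : Set V} (h₁ : δ₁ ∈ G.C)
    (hd : Disjoint δ₁ δ₂) : δ₁ ⊆ G.rightOf δ₂ ∨ Disjoint δ₁ (G.rightOf δ₂) := by
  by_cases h : ∃ v ∈ δ₁, v ∈ G.rightOf δ₂
  · exact Or.inl (hG.conn _ h₁ _ h fun v _ w hw hr hvU =>
      Reach.step (fun hw' => Set.disjoint_left.1 hd hw hw') hr hvU)
  · push Not at h
    exact Or.inr (Set.disjoint_left.2 h)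

lemma Lawful.exists_reach_univ (hG : G.Lawful) : ∃ v ∈ G.left, G.Reach Set.univ v := by
  by_contra! h
  obtain ⟨δ, hδ, hs⟩ := hG.exists_of_blocks ∅ (by simpa using h)
  exact (hG.nonempty δ hδ).ne_empty (Set.subset_empty_iff.1 hs)

/-- Disjoint vertical crossings are ordered from left to right. -/
lemma Lawful.ordered (hG : G.Lawful) {δ₁ δ₂ : Set V} (h₁ : δ₁ ∈ G.C) (h₂ : δ₂ ∈ G.C)
    (hd : Disjoint δ₁ δ₂) :
    (δ₁ ⊆ G.rightOf δ₂ ∧ Disjoint δ₂ (G.rightOf δ₁)) ∨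
      (δ₂ ⊆ G.rightOf δ₁ ∧ Disjoint δ₁ (G.rightOf δ₂)) := by
  rcases hG.subset_rightOf_or h₁ hd with a | a <;> rcases hG.subset_rightOf_or h₂ hd.symm with b | b
  -- If each were to the right of the other, their left envelope would be empty.
  · obtain ⟨δ, hδ, hs, d1, d2⟩ := hG.exists_meet h₁ h₂
    obtain ⟨v, hv⟩ := hG.nonempty δ hδ
    exact ((hs hv).elim (fun h => Set.disjoint_left.1 d2 hv (a h))
      (fun h => Set.disjoint_left.1 d1 hv (b h))).elim
  · exact Or.inl ⟨a, b⟩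
  · exact Or.inr ⟨b, a⟩
  -- If neither is to the right of the other, the right sides coincide. Each crossing is then
  -- invisible to the other, and any unrestricted chain from left to right lies in the common right
  -- side.
  · have e : G.rightOf δ₁ = G.rightOf δ₂ := (rightOf_mono b).antisymm (rightOf_mono a)
    obtain ⟨v, hv, hr⟩ := hG.exists_reach_univ
    refine (hG.blocks _ h₁ v hv ?_).elim
    change v ∈ G.rightOf δ₁
    clear hv
    induction hr with
    | @base v _ hr =>
      by_cases h : v ∈ δ₁
      · rw [e]; exact .base (Set.disjoint_left.1 hd h) hr
      · exact .base h hr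
    | @step v w _ hr _ ih =>
      by_cases h : v ∈ δ₁
      · rw [e] at ih ⊢; exact Reach.step (Set.disjoint_left.1 hd h) hr ih
      · exact Reach.step h hr ih

/-! ### Leftmost monochromatic crossings -/

/-- `δ` is a vertical crossing contained in `W` of colour `c`. -/
def IsCol (G : CrossingSystem V) (W : Set V) (ω : V → Bool) (c : Bool) (δ : Set V) : Prop :=
  δ ∈ G.C ∧ δ ⊆ W ∧ ∀ v ∈ δ, ω v = c

/-- `δ` is a monochromatic vertical crossing contained in `W`. -/
def IsMono (G : CrossingSystem V) (W : Set V) (ω : V → Bool) (δ : Set V) : Prop :=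
  ∃ c, G.IsCol W ω c δ

/-- `δ` is a leftmost monochromatic vertical crossing contained in `W`. -/
def IsLeftmost (G : CrossingSystem V) (W : Set V) (ω : V → Bool) (δ : Set V) : Prop :=
  G.IsMono W ω δ ∧ ∀ δ', G.IsMono W ω δ' → G.rightOf δ' ⊆ G.rightOf δ

/-- The numbers of disjoint monochromatic vertical crossings contained in `W`. -/
def counts (G : CrossingSystem V) (W : Set V) (ω : V → Bool) : Set ℕ :=
  {m | ∃ δ : Fin m → Set V, (∀ i, G.IsMono W ω (δ i)) ∧ ∀ i j, i ≠ j → Disjoint (δ i) (δ j)}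

/-- A crossing with maximal right side works. It is comparable with every disjoint crossing by
`Lawful.ordered`; an intersecting monochromatic crossing has the same colour, so the left envelope
of the two is again monochromatic. -/
lemma Lawful.exists_isLeftmost [Finite V] (hG : G.Lawful) {W : Set V} {ω : V → Bool}
    (h : ∃ δ, G.IsMono W ω δ) : ∃ δ, G.IsLeftmost W ω δ := by
  obtain ⟨γ, hγ, hmax⟩ := Set.Finite.exists_maximalFor (fun δ => G.rightOf δ)
    {δ | G.IsMono W ω δ} (Set.toFinite _) h
  refine ⟨γ, hγ, fun δ hδ => ?_⟩
  obtain ⟨c, hc⟩ := hγ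
  obtain ⟨d, hd⟩ := hδ
  by_cases hdis : Disjoint γ δ
  · rcases hG.ordered hc.1 hd.1 hdis with ⟨_, h⟩ | ⟨_, h⟩
    · exact hmax ⟨d, hd⟩ (rightOf_mono h)
    · exact rightOf_mono h
  · obtain ⟨v, hv, hv'⟩ := Set.not_disjoint_iff.1 hdis
    have hcd : c = d := (hc.2.2 v hv).symm.trans (hd.2.2 v hv')
    subst hcd
    obtain ⟨ε, hε, hs, d1, d2⟩ := hG.exists_meet hc.1 hd.1
    have hεm : G.IsMono W ω ε := ⟨c, hε, fun v hv => (hs hv).elim (hc.2.1 ·) (hd.2.1 ·),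
      fun v hv => (hs hv).elim (hc.2.2 v) (hd.2.2 v)⟩
    exact (rightOf_mono d2).trans (hmax hεm (rightOf_mono d1))

lemma IsMono.congr {W W' : Set V} {ω ω' : V → Bool} {δ : Set V} (h : G.IsMono W ω δ)
    (hW : δ ⊆ W') (hω : ∀ v ∈ δ, ω v = ω' v) : G.IsMono W' ω' δ := by
  obtain ⟨c, h1, h2, h3⟩ := h
  exact ⟨c, h1, hW, fun v hv => (hω v hv).symm.trans (h3 v hv)⟩

lemma IsMono.not {W : Set V} {ω ω' : V → Bool} {δ : Set V} (h : G.IsMono W ω δ)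
    (hω : ∀ v ∈ δ, ω' v = !(ω v)) : G.IsMono W ω' δ := by
  obtain ⟨c, h1, h2, h3⟩ := h
  exact ⟨!c, h1, h2, fun v hv => by rw [hω v hv, h3 v hv]⟩

/-- What lies right of the leftmost crossing is determined by the colours in the remaining part,
up to swapping colours. -/
lemma IsLeftmost.congr {W : Set V} {ω ω' : V → Bool} {γ γ' : Set V}
    (h : G.IsLeftmost W ω γ) (h' : G.IsLeftmost W ω' γ')
    (hω : (∀ v ∈ W \ G.rightOf γ, ω' v = ω v) ∨ ∀ v ∈ W \ G.rightOf γ, ω' v = !(ω v)) :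
    G.rightOf γ' = G.rightOf γ := by
  have sub : ∀ {ω γ}, G.IsLeftmost W ω γ → ∀ v ∈ γ, v ∈ W \ G.rightOf γ := fun h v hv =>
    ⟨h.1.choose_spec.2.1 hv, Set.disjoint_left.1 (disjoint_rightOf _) hv⟩
  have tr : ∀ δ, (∀ v ∈ δ, v ∈ W \ G.rightOf γ) → (G.IsMono W ω δ ↔ G.IsMono W ω' δ) := by
    intro δ hδ
    rcases hω with hω | hω
    · exact ⟨fun h => h.congr (fun v hv => (hδ v hv).1) fun v hv => (hω v (hδ v hv)).symm,
        fun h => h.congr (fun v hv => (hδ v hv).1) fun v hv => hω v (hδ v hv)⟩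
    · exact ⟨fun h => h.not fun v hv => hω v (hδ v hv),
        fun h => h.not fun v hv => by rw [hω v (hδ v hv), Bool.not_not]⟩
  have h1 : G.rightOf γ ⊆ G.rightOf γ' := h'.2 _ ((tr γ (sub h)).1 h.1)
  refine Set.Subset.antisymm (h.2 _ ((tr γ' fun v hv => ?_).2 h'.1)) h1
  exact ⟨(sub h' v hv).1, fun hn => (sub h' v hv).2 (h1 hn)⟩

/-- Any competitor for `ω'` that is at least as far left avoids `G.rightOf γ`, hence is
monochromatic for `ω` as well. Colours inside `G.rightOf γ` are arbitrary here. -/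
lemma IsLeftmost.of_eqOn [Finite V] (hG : G.Lawful) {W : Set V} {ω ω' : V → Bool} {γ : Set V}
    (h : G.IsLeftmost W ω γ)
    (hω : (∀ v ∈ W \ G.rightOf γ, ω' v = ω v) ∨ ∀ v ∈ W \ G.rightOf γ, ω' v = !(ω v)) :
    G.IsLeftmost W ω' γ := by
  have sub : ∀ v ∈ γ, v ∈ W \ G.rightOf γ := fun v hv =>
    ⟨h.1.choose_spec.2.1 hv, Set.disjoint_left.1 (disjoint_rightOf _) hv⟩
  have hm : G.IsMono W ω' γ := by
    rcases hω with hω | hω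
    · exact h.1.congr (fun v hv => (sub v hv).1) fun v hv => (hω v (sub v hv)).symm
    · exact h.1.not fun v hv => hω v (sub v hv)
  obtain ⟨γ', h'⟩ := hG.exists_isLeftmost ⟨γ, hm⟩
  exact ⟨hm, fun δ hδ => (h'.2 δ hδ).trans (h.congr h' hω).subset⟩

lemma Lawful.card_le [Finite V] (hG : G.Lawful) {W : Set V} {ω : V → Bool} {m : ℕ}
    (hm : m ∈ G.counts W ω) : m ≤ Nat.card V := by
  obtain ⟨δ, hδ, hd⟩ := hm
  choose x hx using fun i => hG.nonempty (δ i) (hδ i).choose_spec.1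
  have : Function.Injective x := fun i j hij => by
    by_contra hne
    exact Set.disjoint_left.1 (hd i j hne) (hx i) (hij ▸ hx j)
  simpa using Nat.card_le_card_of_injective x this

/-- The maximal number of disjoint monochromatic vertical crossings contained in `W`. -/
noncomputable def maxCount (G : CrossingSystem V) (W : Set V) (ω : V → Bool) : ℕ :=
  sSup (G.counts W ω)

lemma Lawful.isGreatest [Finite V] (hG : G.Lawful) (W : Set V) (ω : V → Bool) :
    IsGreatest (G.counts W ω) (G.maxCount W ω) := by
  have hb : BddAbove (G.counts W ω) := ⟨_, fun m hm => hG.card_le hm⟩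
  exact ⟨Nat.sSup_mem ⟨0, Fin.elim0, fun i => i.elim0, fun i => i.elim0⟩ hb,
    fun m hm => le_csSup hb hm⟩

/-- The greedy choice is optimal: in a disjoint family, at most one member fails to lie to the right
of `γ`. -/
lemma Lawful.maxCount_eq_succ [Finite V] (hG : G.Lawful) {W : Set V} {ω : V → Bool} {γ : Set V}
    (h : G.IsLeftmost W ω γ) :
    G.maxCount W ω = G.maxCount (W ∩ G.rightOf γ) ω + 1 := by
  refine (hG.isGreatest W ω).unique ⟨?_, ?_⟩
  · obtain ⟨δ, hδ, hd⟩ := (hG.isGreatest (W ∩ G.rightOf γ) ω).1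
    have hγ : ∀ i, Disjoint γ (δ i) := fun i => (disjoint_rightOf γ).mono_right
      ((hδ i).choose_spec.2.1.trans Set.inter_subset_right)
    refine ⟨Fin.cons γ δ, fun i => ?_, fun i j => ?_⟩
    · refine Fin.cases h.1 (fun i => ?_) i
      exact (hδ i).congr ((hδ i).choose_spec.2.1.trans Set.inter_subset_left) fun _ _ => rfl
    · refine Fin.cases ?_ (fun i => ?_) i <;> refine Fin.cases ?_ (fun j => ?_) j
      · simp
      · exact fun _ => hγ j
      · exact fun _ => (hγ i).symm
      · simpa using fun hij => hd i j hij
  · rintro m ⟨δ, hδ, hd⟩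
    by_cases hall : ∀ i, δ i ⊆ G.rightOf γ
    · refine ((hG.isGreatest (W ∩ G.rightOf γ) ω).2 ⟨δ, fun i => ?_, hd⟩).trans (Nat.le_succ _)
      exact (hδ i).congr (Set.subset_inter (hδ i).choose_spec.2.1 (hall i)) fun _ _ => rfl
    · push Not at hall
      obtain ⟨i, hi⟩ := hall
      obtain _ | m := m
      · exact i.elim0
      refine Nat.succ_le_succ ((hG.isGreatest (W ∩ G.rightOf γ) ω).2
        ⟨fun j => δ (i.succAbove j), fun j => ?_, fun j k hjk => hd _ _ (by simpa using hjk)⟩)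
      refine (hδ _).congr (Set.subset_inter (hδ _).choose_spec.2.1 ?_) fun _ _ => rfl
      -- If `δ i` were to the right of another member, it would be to the right of `γ`; so all
      -- others are to the right of `δ i`, hence of `γ`.
      rcases hG.ordered (hδ i).choose_spec.1 (hδ (i.succAbove j)).choose_spec.1
        (hd _ _ (Fin.succAbove_ne i j).symm) with ⟨h1, _⟩ | ⟨h1, _⟩
      · exact (hi (h1.trans (h.2 _ (hδ _)))).elim
      · exact h1.trans (h.2 _ (hδ _))

/-- There is no crossing of colour `c` in `W`. -/
def NoCol (G : CrossingSystem V) (W : Set V) (c : Bool) (ω : V → Bool) : Prop :=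
  ∀ δ, ¬ G.IsCol W ω c δ

/-- A crossing of the colour opposite to that of `γ` is disjoint from `γ`, so by leftmostness it
lies to the right of `γ`. -/
lemma Lawful.noCol_iff [Finite V] (hG : G.Lawful) {W : Set V} {ω : V → Bool} {γ : Set V}
    (h : G.IsLeftmost W ω γ) (c : Bool) :
    G.NoCol W c ω ↔ G.IsCol W ω (!c) γ ∧ G.NoCol (W ∩ G.rightOf γ) c ω := by
  constructor
  · intro hn
    refine ⟨?_, fun δ hδ => hn δ ⟨hδ.1, hδ.2.1.trans Set.inter_subset_left, hδ.2.2⟩⟩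
    obtain ⟨d, hd⟩ := h.1
    have : d ≠ c := fun e => hn γ (e ▸ hd)
    rwa [← Bool.eq_not_of_ne this]
  · rintro ⟨hγ, hn⟩ δ hδ
    have hdis : Disjoint γ δ := Set.disjoint_left.2 fun v h1 h2 => by
      have := hγ.2.2 v h1; rw [hδ.2.2 v h2] at this; cases c <;> simp at this
    have hR := h.2 δ ⟨c, hδ⟩
    rcases hG.ordered hγ.1 hδ.1 hdis with ⟨h1, _⟩ | ⟨h1, _⟩
    · obtain ⟨v, hv⟩ := hG.nonempty γ hγ.1
      exact Set.disjoint_left.1 (disjoint_rightOf γ) hv (hR (h1 hv))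
    · exact hn δ ⟨hδ.1, Set.subset_inter hδ.2.1 h1, hδ.2.2⟩

lemma noCol_congr {W : Set V} {ω ω' : V → Bool} (h : ∀ v ∈ W, ω v = ω' v) (c : Bool) :
    G.NoCol W c ω ↔ G.NoCol W c ω' := by
  constructor <;> intro hn δ hδ <;> refine hn δ ⟨hδ.1, hδ.2.1, fun v hv => ?_⟩
  · rw [h v (hδ.2.1 hv), hδ.2.2 v hv]
  · rw [← h v (hδ.2.1 hv), hδ.2.2 v hv]

/-! ### Colour switching -/

open Classical in
/-- What lies right of the leftmost monochromatic crossing in `W`, if there is one. -/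
noncomputable def rightPart (G : CrossingSystem V) (W : Set V) (ω : V → Bool) : Option (Set V) :=
  if h : ∃ γ, G.IsLeftmost W ω γ then some (G.rightOf h.choose) else none

/-- Leftmost crossings need not be unique, but their right side is, so the choice in `rightPart` is
harmless. -/
lemma rightPart_eq_some {W U : Set V} {ω : V → Bool} :
    G.rightPart W ω = some U ↔ ∃ γ, G.IsLeftmost W ω γ ∧ G.rightOf γ = U := by
  unfold rightPart
  split_ifs with h
  · rw [Option.some_inj]
    refine ⟨fun e => ⟨_, h.choose_spec, e⟩, ?_⟩
    rintro ⟨γ, h1, rfl⟩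
    exact h1.congr h.choose_spec (Or.inl fun _ _ => rfl)
  · simp only [false_iff]
    rintro ⟨γ, h1, -⟩
    exact h ⟨γ, h1⟩

lemma rightPart_eq_none [Finite V] (hG : G.Lawful) {W : Set V} {ω : V → Bool}
    (h : G.rightPart W ω = none) (δ : Set V) : ¬ G.IsMono W ω δ := by
  intro hδ
  unfold rightPart at h
  rw [dif_pos (hG.exists_isLeftmost ⟨δ, hδ⟩)] at h
  simp at h

open Classical in
/-- Swap the colours on `D`. -/
noncomputable def flip (D : Set V) (ω : V → Bool) : V → Bool :=
  fun v => if v ∈ D then !(ω v) else ω v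

lemma flip_flip (D : Set V) (ω : V → Bool) : flip D (flip D ω) = ω := by
  funext v; unfold flip; split_ifs <;> simp

open Classical in
/-- The indicator of `NoCol`. -/
noncomputable def noColInd (G : CrossingSystem V) (W : Set V) (c : Bool) (ω : V → Bool) : ℝ :=
  if G.NoCol W c ω then 1 else 0

lemma Lawful.trivial_of_no_mono [Finite V] (hG : G.Lawful) {W : Set V} {ω : V → Bool}
    (hno : ∀ δ, ¬ G.IsMono W ω δ) (c : Bool) :
    G.noColInd W c ω = 1 ∧ G.maxCount W ω = 0 := by
  refine ⟨if_pos fun δ hδ => hno δ ⟨c, hδ⟩, ?_⟩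
  obtain ⟨δ, hδ, -⟩ := (hG.isGreatest W ω).1
  by_contra h
  exact hno _ (hδ ⟨0, Nat.pos_of_ne_zero h⟩)

/-- Colour switching, with a weight `g` that does not depend on the colours in `W`. -/
theorem Lawful.sum_noCol [Fintype V] [DecidableEq V] (hG : G.Lawful) (c : Bool) (n : ℕ) :
    ∀ W : Set V, W.ncard ≤ n → ∀ g : (V → Bool) → ℝ,
    (∀ ω ω', (∀ v ∉ W, ω v = ω' v) → g ω = g ω') →
    ∑ ω, g ω * G.noColInd W c ω = ∑ ω, g ω * (1 / 2) ^ G.maxCount W ω := by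
  classical
  induction n with
  | zero =>
    intro W hW g _
    have hW' : W = ∅ := by
      rwa [Nat.le_zero, Set.ncard_eq_zero] at hW
    subst hW'
    have hno : ∀ ω δ, ¬ G.IsMono ∅ ω δ := fun ω δ ⟨_, h⟩ =>
      (hG.nonempty δ h.1).ne_empty (Set.subset_empty_iff.1 h.2.1)
    refine Finset.sum_congr rfl fun ω _ => ?_
    obtain ⟨h1, h0⟩ := hG.trivial_of_no_mono (hno ω) c
    rw [h1, h0, pow_zero]
  | succ n ih =>
    intro W hW g hg
    rw [← Finset.sum_fiberwise _ (G.rightPart W), ← Finset.sum_fiberwise _ (G.rightPart W)]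
    refine Finset.sum_congr rfl fun o _ => ?_
    rcases o with _ | U
    · refine Finset.sum_congr rfl fun ω hω => ?_
      obtain ⟨h1, h0⟩ := hG.trivial_of_no_mono
        (rightPart_eq_none hG (Finset.mem_filter.1 hω).2) c
      rw [h1, h0, pow_zero]
    -- Conditioning on the right part being `U`. The restricted weight does not depend on the
    -- colours in `W ∩ U`, so the induction hypothesis applies to it.
    · set g' : (V → Bool) → ℝ := fun ω => if G.rightPart W ω = some U then g ω else 0 with hg'
      have conv : ∀ F : (V → Bool) → ℝ,
          ∑ ω with G.rightPart W ω = some U, g ω * F ω = ∑ ω, g' ω * F ω := by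
        intro F
        rw [Finset.sum_filter]
        exact Finset.sum_congr rfl fun ω _ => by simp only [hg']; split_ifs <;> simp
      rw [conv, conv]
      have inv : ∀ ω ω', ((∀ v ∈ W \ U, ω' v = ω v) ∨ ∀ v ∈ W \ U, ω' v = !(ω v)) →
          G.rightPart W ω = some U → G.rightPart W ω' = some U := by
        intro ω ω' h h1
        obtain ⟨γ, hγ, rfl⟩ := (rightPart_eq_some).1 h1
        exact (rightPart_eq_some).2 ⟨γ, hγ.of_eqOn hG h, rfl⟩
      by_cases hex : ∃ ω, G.rightPart W ω = some U
      swap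
      · push Not at hex
        simp [hg', hex]
      have hcard : (W ∩ U).ncard ≤ n := by
        obtain ⟨ω, hω⟩ := hex
        obtain ⟨γ, hγ, rfl⟩ := (rightPart_eq_some).1 hω
        obtain ⟨v, hv⟩ := hG.nonempty γ hγ.1.choose_spec.1
        have : (W ∩ G.rightOf γ).ncard < W.ncard := Set.ncard_lt_ncard
          ⟨Set.inter_subset_left, fun h => Set.disjoint_left.1 (disjoint_rightOf γ) hv
            (h (hγ.1.choose_spec.2.1 hv)).2⟩ (Set.toFinite _)
        omega
      have hgU : ∀ ω ω', (∀ v ∉ W ∩ U, ω v = ω' v) → g' ω = g' ω' := by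
        intro ω ω' h
        have e : G.rightPart W ω = some U ↔ G.rightPart W ω' = some U :=
          ⟨inv ω ω' (Or.inl fun v hv => (h v fun h' => hv.2 h'.2).symm),
            inv ω' ω (Or.inl fun v hv => h v fun h' => hv.2 h'.2)⟩
        have e' : g ω = g ω' := hg ω ω' fun v hv => h v fun h' => hv h'.1
        simp only [hg', e, e']
      have main := ih (W ∩ U) hcard g' hgU
      have e1 : ∀ ω, g' ω * (1 / 2) ^ G.maxCount W ω =
          (1 / 2) * (g' ω * (1 / 2) ^ G.maxCount (W ∩ U) ω) := by
        intro ω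
        by_cases h : G.rightPart W ω = some U
        · obtain ⟨γ, hγ, rfl⟩ := (rightPart_eq_some).1 h
          rw [hG.maxCount_eq_succ hγ]; ring
        · simp [hg', h]
      simp_rw [e1]
      rw [← Finset.mul_sum, ← main]
      have hflip : ∀ ω, ∀ v ∈ W \ U, flip (W \ U) ω v = !(ω v) := fun ω v hv => by
        simp [flip, hv]
      have hflip' : ∀ ω, ∀ v ∉ W \ U, flip (W \ U) ω v = ω v := fun ω v hv => by
        unfold flip; rw [if_neg hv]
      have hbij : ∑ ω, g' ω * G.noColInd W c ω =
          ∑ ω, g' ω * G.noColInd W c (flip (W \ U) ω) := by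
        refine Finset.sum_equiv
          ⟨flip (W \ U), flip (W \ U), flip_flip _, flip_flip _⟩ (by simp) fun ω _ => ?_
        simp only [Equiv.coe_fn_mk, flip_flip]
        congr 1
        have e : G.rightPart W ω = some U ↔ G.rightPart W (flip (W \ U) ω) = some U := by
          refine ⟨inv _ _ (Or.inr (hflip ω)), inv _ _ (Or.inr fun v hv => ?_)⟩
          rw [hflip ω v hv, Bool.not_not]
        have e' : g ω = g (flip (W \ U) ω) :=
          hg _ _ fun v hv => (hflip' ω v fun h => hv h.1).symm
        simp only [hg', e, e']
      -- Swapping the colours on `W \ U` keeps `γ` leftmost and reverses its colour, so for exactly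
      -- one of the two colourings `γ` has the colour `!c` required by `Lawful.noCol_iff`.
      have hsum : ∀ ω, g' ω * G.noColInd W c ω + g' ω * G.noColInd W c (flip (W \ U) ω) =
          g' ω * G.noColInd (W ∩ U) c ω := by
        intro ω
        by_cases h : G.rightPart W ω = some U
        swap
        · simp [hg', h]
        rw [← mul_add]
        congr 1
        obtain ⟨γ, hγ, rfl⟩ := (rightPart_eq_some).1 h
        have hγ' : G.IsLeftmost W (flip (W \ G.rightOf γ) ω) γ :=
          hγ.of_eqOn hG (Or.inr (hflip ω))
        have e : G.NoCol (W ∩ G.rightOf γ) c (flip (W \ G.rightOf γ) ω) ↔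
            G.NoCol (W ∩ G.rightOf γ) c ω :=
          noCol_congr (fun v hv => hflip' ω v fun h => h.2 hv.2) c
        unfold noColInd
        rw [hG.noCol_iff hγ, hG.noCol_iff hγ', e]
        obtain ⟨d, hd⟩ := hγ.1
        obtain ⟨v, hv⟩ := hG.nonempty γ hd.1
        have sub : ∀ v ∈ γ, v ∈ W \ G.rightOf γ := fun v hv =>
          ⟨hd.2.1 hv, Set.disjoint_left.1 (disjoint_rightOf _) hv⟩
        have hd' : G.IsCol W (flip (W \ G.rightOf γ) ω) (!d) γ :=
          ⟨hd.1, hd.2.1, fun v hv => by rw [hflip ω v (sub v hv), hd.2.2 v hv]⟩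
        have uniq : ∀ {ω a b}, G.IsCol W ω a γ → (G.IsCol W ω b γ ↔ b = a) := fun {ω a b} ha =>
          ⟨fun hb => (hb.2.2 v hv).symm.trans (ha.2.2 v hv), fun e => e ▸ ha⟩
        rw [uniq hd, uniq hd']
        by_cases hn : G.NoCol (W ∩ G.rightOf γ) c ω <;> cases c <;> cases d <;> simp [hn]
      have : ∑ ω, g' ω * G.noColInd W c ω + ∑ ω, g' ω * G.noColInd W c ω =
          ∑ ω, g' ω * G.noColInd (W ∩ U) c ω := by
        -- The rewrite affects both equal summands; the first one is turned back.
        conv_lhs => rw [hbij]; arg 1; rw [← hbij]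
        rw [← Finset.sum_add_distrib]
        exact Finset.sum_congr rfl fun ω _ => hsum ω
      linarith

end CrossingSystem

/-! ### Planar topology by continuous logarithms -/

section Topology

lemma exists_continuous_log {g : ℝ × ℝ → ℂ} (hg : Continuous g) (h0 : ∀ x, g x ≠ 0) :
    ∃ f : ℝ × ℝ → ℂ, Continuous f ∧ ∀ x, Complex.exp (f x) = g x := by
  obtain ⟨f, hf, he⟩ := Complex.exists_continuousOn_eqOn_exp_comp (X := ℝ × ℝ) (U := Set.univ)
    (by
      have := (convex_univ (𝕜 := ℝ) (E := ℝ × ℝ)).contractibleSpace ⟨0, trivial⟩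
      exact SimplyConnectedSpace.ofContractible _) isOpen_univ hg.continuousOn
    (by rintro ⟨x, -, hx⟩; exact h0 x hx)
  exact ⟨f, continuousOn_univ.1 hf, fun x => he (Set.mem_univ x)⟩

/-- Two lifts through the covering map `exp` that agree at one point agree everywhere. -/
lemma sub_eq_sub_of_exp_eq {f g : ℝ → ℂ} (hf : Continuous f) (hg : Continuous g)
    (h : ∀ t, Complex.exp (f t) = Complex.exp (g t)) (a b : ℝ) : f b - f a = g b - g a := by
  have := Complex.isCoveringMap_exp.eq_of_comp_eq (g₁ := f) (g₂ := fun t => g t + (f a - g a)) hf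
    (by fun_prop) (by
      funext t
      ext
      simp [Complex.exp_add, Complex.exp_sub, h]) a (by ring)
  rw [congrFun this b]; ring

/-- The range of `f` on the interval is connected, so it cannot jump over an open gap where the sine
is negative. -/
lemma exists_int_band {f : ℝ → ℝ} (hf : Continuous f)
    (h : ∀ t ∈ Set.Icc (0 : ℝ) 1, 0 ≤ Real.sin (f t)) :
    ∃ k : ℤ, ∀ t ∈ Set.Icc (0 : ℝ) 1, 2 * k * Real.pi ≤ f t ∧ f t ≤ (2 * k + 1) * Real.pi := by
  have hpi := Real.pi_pos
  have hsin : ∀ (k : ℤ) (y : ℝ), (2 * k + 1) * Real.pi < y → y < (2 * k + 2) * Real.pi →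
      Real.sin y < 0 := by
    intro k y h1 h2
    have := Real.sin_pos_of_pos_of_lt_pi (x := y - (2 * k + 1) * Real.pi) (by linarith)
      (by linarith)
    have e : y = (y - (2 * k + 1) * Real.pi) + Real.pi + k * (2 * Real.pi) := by ring
    rw [e, Real.sin_add_int_mul_two_pi, Real.sin_add_pi]
    linarith
  have hcon : (f '' Set.Icc 0 1).OrdConnected :=
    (isPreconnected_Icc.image f hf.continuousOn).ordConnected
  have hmem : ∀ t ∈ Set.Icc (0 : ℝ) 1, f t ∈ f '' Set.Icc 0 1 := fun t ht => ⟨t, ht, rfl⟩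
  have hneg : ∀ y ∈ f '' Set.Icc 0 1, 0 ≤ Real.sin y := by rintro _ ⟨t, ht, rfl⟩; exact h t ht
  have h0 := hmem 0 (by simp)
  set k := ⌊f 0 / (2 * Real.pi)⌋ with hk
  have hk1 : 2 * k * Real.pi ≤ f 0 := by
    have := Int.floor_le (f 0 / (2 * Real.pi))
    rw [le_div_iff₀ (by positivity)] at this
    linarith
  have hk2 : f 0 < (2 * k + 2) * Real.pi := by
    have := Int.lt_floor_add_one (f 0 / (2 * Real.pi))
    rw [div_lt_iff₀ (by positivity)] at this
    linarith
  have hk3 : f 0 ≤ (2 * k + 1) * Real.pi := by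
    by_contra! hlt
    linarith [hsin k _ hlt hk2, hneg _ h0]
  refine ⟨k, fun t ht => ⟨?_, ?_⟩⟩
  · by_contra! hlt
    -- An intermediate value inside the gap just below the band, where the sine is negative.
    have h2 : max (f t) ((2 * k - 1 / 2) * Real.pi) ∈ f '' Set.Icc 0 1 :=
      hcon.out (hmem t ht) h0 ⟨le_max_left _ _, max_le (by linarith) (by linarith)⟩
    have := hsin (k - 1) (max (f t) ((2 * k - 1 / 2) * Real.pi))
      (lt_max_of_lt_right (by push_cast; linarith))
      (max_lt (by push_cast; linarith) (by push_cast; linarith))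
    linarith [hneg _ h2]
  · by_contra! hlt
    have h2 : min (f t) ((2 * k + 3 / 2) * Real.pi) ∈ f '' Set.Icc 0 1 :=
      hcon.out h0 (hmem t ht) ⟨le_min (by linarith) (by linarith), min_le_left _ _⟩
    have := hsin k _ (lt_min hlt (by linarith : _ < (2 * k + 3 / 2) * Real.pi))
      (min_lt_of_right_lt (by linarith))
    linarith [hneg _ h2]

/-- A horizontal and a vertical crossing of a rectangle meet. -/
theorem exists_eq_of_crossings {x₀ x₁ y₀ y₁ : ℝ} {γ δ : C(unitInterval, Plane)}
    (hγ : IsHorizontalCrossing x₀ x₁ y₀ y₁ γ) (hδ : IsVerticalCrossing x₀ x₁ y₀ y₁ δ) :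
    ∃ s t, γ s = δ t := by
  by_contra! hne
  set pr : ℝ → unitInterval := Set.projIcc 0 1 zero_le_one with hpr
  have hprc : Continuous pr := continuous_projIcc
  have pr0 : pr 0 = 0 := Set.projIcc_left _
  have pr1 : pr 1 = 1 := Set.projIcc_right _
  -- The difference of the two paths as a function on the parameter square. On each side of the
  -- square it stays in a half-plane, and these half-planes force it to wind once around 0, which a
  -- function with a logarithm cannot do.
  set F : ℝ × ℝ → ℂ := fun z => ((γ (pr z.1) 0 - δ (pr z.2) 0 : ℝ) : ℂ) +
    ((γ (pr z.1) 1 - δ (pr z.2) 1 : ℝ) : ℂ) * Complex.I with hF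
  have hFc : Continuous F := by fun_prop
  have hre : ∀ z, (F z).re = γ (pr z.1) 0 - δ (pr z.2) 0 := fun z => by simp [hF]
  have him : ∀ z, (F z).im = γ (pr z.1) 1 - δ (pr z.2) 1 := fun z => by simp [hF]
  obtain ⟨f, hf, hfe⟩ := exists_continuous_log hFc (fun z hz => hne (pr z.1) (pr z.2) (by
    have h1 := hre z
    have h2 := him z
    rw [hz] at h1 h2
    ext i
    fin_cases i
    · simpa [sub_eq_zero] using h1.symm
    · simpa [sub_eq_zero] using h2.symm))
  have hcos : ∀ z, 0 ≤ Real.cos (f z).im ↔ 0 ≤ (F z).re := fun z => by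
    rw [← hfe, Complex.exp_re, mul_nonneg_iff_of_pos_left (Real.exp_pos _)]
  have hcos' : ∀ z, Real.cos (f z).im ≤ 0 ↔ (F z).re ≤ 0 := fun z => by
    rw [← not_lt, ← not_lt, ← hfe, Complex.exp_re, mul_pos_iff_of_pos_left (Real.exp_pos _)]
  have hsin : ∀ z, 0 ≤ Real.sin (f z).im ↔ 0 ≤ (F z).im := fun z => by
    rw [← hfe, Complex.exp_im, mul_nonneg_iff_of_pos_left (Real.exp_pos _)]
  have hsin' : ∀ z, Real.sin (f z).im ≤ 0 ↔ (F z).im ≤ 0 := fun z => by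
    rw [← not_lt, ← not_lt, ← hfe, Complex.exp_im, mul_pos_iff_of_pos_left (Real.exp_pos _)]
  have hpi := Real.pi_pos
  obtain ⟨m, hm⟩ := exists_int_band (f := fun s => (f (s, 0)).im) (by fun_prop) (fun s _ => by
    rw [hsin, him, pr0, hδ.2.1]; linarith [(hγ.1 (pr s)).2.1])
  obtain ⟨n, hn⟩ := exists_int_band (f := fun t => (f (1, t)).im + Real.pi / 2) (by fun_prop)
    (fun t _ => by
      rw [Real.sin_add_pi_div_two, hcos, hre, pr1, hγ.2.2]; linarith [(hδ.1 (pr t)).1.2])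
  obtain ⟨p, hp⟩ := exists_int_band (f := fun s => (f (s, 1)).im + Real.pi) (by fun_prop)
    (fun s _ => by
      rw [Real.sin_add_pi, neg_nonneg, hsin', him, pr1, hδ.2.2]; linarith [(hγ.1 (pr s)).2.2])
  obtain ⟨q, hq⟩ := exists_int_band (f := fun t => (f (0, t)).im - Real.pi / 2) (by fun_prop)
    (fun t _ => by
      rw [Real.sin_sub_pi_div_two, neg_nonneg, hcos', hre, pr0, hγ.2.1]
      linarith [(hδ.1 (pr t)).1.1])
  -- At a corner, two bands of half a turn offset by a quarter turn share a value, which ties their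
  -- indices; `c` and `d` are the offsets `∓ 1 / 2` in units of `π`.
  have cmp : ∀ a b : ℤ, ∀ c d : ℝ, c < 1 → d < 1 → 2 * a * Real.pi ≤ (2 * b + 1 + c) * Real.pi →
      2 * b * Real.pi ≤ (2 * a + 1 + d) * Real.pi → a = b := by
    intro a b c d hc hd h1 h2
    have h1 := le_of_mul_le_mul_right h1 hpi
    have h2 := le_of_mul_le_mul_right h2 hpi
    have h3 : (a : ℝ) < b + 1 := by linarith
    have h4 : (b : ℝ) < a + 1 := by linarith
    have h3 : a < b + 1 := by exact_mod_cast h3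
    have h4 : b < a + 1 := by exact_mod_cast h4
    omega
  have z0 : (0 : ℝ) ∈ Set.Icc (0 : ℝ) 1 := by simp
  have z1 : (1 : ℝ) ∈ Set.Icc (0 : ℝ) 1 := by simp
  have e1 : m = n := cmp m n (-1 / 2) (1 / 2) (by norm_num) (by norm_num)
    (by linarith [hm 1 z1, hn 0 z0]) (by linarith [hm 1 z1, hn 0 z0])
  have e2 : n = p := cmp n p (-1 / 2) (1 / 2) (by norm_num) (by norm_num)
    (by linarith [hn 1 z1, hp 1 z1]) (by linarith [hn 1 z1, hp 1 z1])
  have e3 : p = q + 1 := cmp p (q + 1) (-1 / 2) (1 / 2) (by norm_num) (by norm_num)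
    (by push_cast; linarith [hp 0 z0, hq 1 z1]) (by push_cast; linarith [hp 0 z0, hq 1 z1])
  have e4 : q = m := cmp q m (-1 / 2) (1 / 2) (by norm_num) (by norm_num)
    (by linarith [hq 0 z0, hm 0 z0]) (by linarith [hq 0 z0, hm 0 z0])
  omega

lemma convex_rect (x₀ x₁ y₀ y₁ : ℝ) : Convex ℝ (rect x₀ x₁ y₀ y₁) := by
  intro p hp q hq a b ha hb hab
  have h1 := (convex_Icc x₀ x₁) hp.1 hq.1 ha hb hab
  have h2 := (convex_Icc y₀ y₁) hp.2 hq.2 ha hb hab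
  exact ⟨by simpa using h1, by simpa using h2⟩

lemma isClosed_rect (x₀ x₁ y₀ y₁ : ℝ) : IsClosed (rect x₀ x₁ y₀ y₁) :=
  (isClosed_Icc.preimage (by fun_prop : Continuous fun p : Plane => p 0)).inter
    (isClosed_Icc.preimage (by fun_prop : Continuous fun p : Plane => p 1))

/-- The retraction of the plane onto a rectangle. -/
noncomputable def clamp (x₀ x₁ y₀ y₁ : ℝ) (z : ℝ × ℝ) : Plane :=
  !₂[max x₀ (min z.1 x₁), max y₀ (min z.2 y₁)]

lemma continuous_clamp (x₀ x₁ y₀ y₁ : ℝ) : Continuous (clamp x₀ x₁ y₀ y₁) := by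
  refine (PiLp.continuous_toLp 2 _).comp (continuous_pi fun i => ?_)
  fin_cases i <;> simp <;> fun_prop

/-- If two disjoint closed sets, the first not meeting the right-hand side and the second not
meeting the left-hand side, do not together separate the bottom from the top, then there is a
vertical crossing avoiding both. -/
theorem exists_vertical_avoiding {x₀ x₁ y₀ y₁ : ℝ} (hx : x₀ < x₁) (hy : y₀ < y₁) {K₁ K₂ : Set Plane}
    (h₁ : IsClosed K₁) (h₂ : IsClosed K₂)
    (hdis : ∀ p ∈ rect x₀ x₁ y₀ y₁, p ∈ K₁ → p ∉ K₂)
    (hr : ∀ p ∈ rect x₀ x₁ y₀ y₁, p 0 = x₁ → p ∉ K₁)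
    (hl : ∀ p ∈ rect x₀ x₁ y₀ y₁, p 0 = x₀ → p ∉ K₂) :
    ∃ γ, IsVerticalCrossing x₀ x₁ y₀ y₁ γ ∧ ∀ t, γ t ∉ K₁ ∧ γ t ∉ K₂ := by
  classical
  set Q := rect x₀ x₁ y₀ y₁ with hQ
  have hQc : IsClosed Q := isClosed_rect _ _ _ _
  set U := Q \ (K₁ ∪ K₂) with hU
  set A := {x | ∃ y, y 1 = y₀ ∧ JoinedIn U y x} with hA
  by_contra! hcon
  have hAU : A ⊆ U := fun x ⟨y, _, h⟩ => h.target_mem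
  have htop : ∀ x ∈ A, x 1 ≠ y₁ := by
    rintro x ⟨y, hy0, hj⟩ hx1
    obtain ⟨t, ht⟩ := hcon hj.somePath.toContinuousMap
      ⟨fun t => (hj.somePath_mem t).1, by simpa using hy0, by simpa using hx1⟩
    have := (hj.somePath_mem t).2
    exact this (by by_cases h : hj.somePath t ∈ K₁; exacts [Or.inl h, Or.inr (ht h)])
  -- Being joined to the bottom is locally constant on `U`, as a ball meets the rectangle in a
  -- convex set.
  have hloc : ∀ x ∈ U, ∃ ε > 0, ∀ y ∈ Q, dist y x < ε → (y ∈ A ↔ x ∈ A) := by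
    intro x hx
    have hnhds : (K₁ ∪ K₂)ᶜ ∈ nhds x := (h₁.union h₂).isOpen_compl.mem_nhds hx.2
    obtain ⟨ε, hε, hb⟩ := Metric.mem_nhds_iff.1 hnhds
    refine ⟨ε, hε, fun y hy hd => ?_⟩
    have hseg : JoinedIn U x y := by
      refine JoinedIn.of_segment_subset fun z hz => ⟨(convex_rect _ _ _ _).segment_subset hx.1 hy hz,
        hb ((convex_ball x ε).segment_subset (Metric.mem_ball_self hε) hd hz)⟩
    exact ⟨fun ⟨w, hw, h⟩ => ⟨w, hw, h.trans hseg.symm⟩, fun ⟨w, hw, h⟩ => ⟨w, hw, h.trans hseg⟩⟩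
  set c := clamp x₀ x₁ y₀ y₁ with hc
  have hcc : Continuous c := continuous_clamp _ _ _ _
  have hc0 : ∀ z, c z 0 = max x₀ (min z.1 x₁) := fun z => by simp [hc, clamp]
  have hc1 : ∀ z, c z 1 = max y₀ (min z.2 y₁) := fun z => by simp [hc, clamp]
  have hcQ : ∀ z, c z ∈ Q := fun z => by
    constructor
    · rw [hc0]; exact ⟨le_max_left _ _, max_le hx.le (min_le_right _ _)⟩
    · rw [hc1]; exact ⟨le_max_left _ _, max_le hy.le (min_le_right _ _)⟩
  have hcl : ∀ t, c (x₀, t) 0 = x₀ := fun t => by simp [hc0, hx.le]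
  have hcr : ∀ t, c (x₁, t) 0 = x₁ := fun t => by simp [hc0, hx.le]
  have hcb : ∀ s, c (s, y₀) 1 = y₀ := fun t => by simp [hc1, hy.le]
  have hct : ∀ s, c (s, y₁) 1 = y₁ := fun t => by simp [hc1, hy.le]
  have hside : ∀ a : ℝ, IsClosed {p : Plane | p 0 = a} := fun a =>
    isClosed_eq (by fun_prop) continuous_const
  -- Urysohn function: 0 on `K₁` and the left side, 1 on `K₂` and the right side.
  obtain ⟨h, h0, h1, -⟩ := exists_continuous_zero_one_of_isClosed
    (s := (K₁ ∩ Q) ∪ ({p | p 0 = x₀} ∩ Q)) (t := (K₂ ∩ Q) ∪ ({p | p 0 = x₁} ∩ Q))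
    ((h₁.inter hQc).union ((hside _).inter hQc)) ((h₂.inter hQc).union ((hside _).inter hQc)) (by
      rw [Set.disjoint_left]
      rintro p (⟨a, b⟩ | ⟨a, b⟩) (⟨d, _⟩ | ⟨d, _⟩)
      · exact hdis p b a d
      · exact hr p b d a
      · exact hl p b a d
      · exact hx.ne (a.symm.trans d))
  -- Half a turn one way on `A`, the other way off `A`. The branches agree where `h` is 0 or 1, in
  -- particular on `K₁ ∪ K₂`, so `g` is continuous.
  set g : ℝ × ℝ → ℂ := fun z => if c z ∈ A then Complex.exp (h (c z) * Real.pi * Complex.I)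
    else Complex.exp (-(h (c z) * Real.pi * Complex.I)) with hg
  have hK : ∀ z, c z ∉ U → Complex.exp (h (c z) * Real.pi * Complex.I) =
      Complex.exp (-(h (c z) * Real.pi * Complex.I)) := by
    intro z hz
    have hz' : c z ∈ K₁ ∪ K₂ := by
      by_contra hcon; exact hz ⟨hcQ z, hcon⟩
    rcases hz' with hz' | hz'
    · simp [h0 (Or.inl ⟨hz', hcQ z⟩ : c z ∈ _)]
    · simp [h1 (Or.inl ⟨hz', hcQ z⟩ : c z ∈ _), Complex.exp_neg, Complex.exp_pi_mul_I]
  have hgc : Continuous g := by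
    refine Continuous.if (fun z hz => hK z fun hzU => ?_) (by fun_prop) (by fun_prop)
    obtain ⟨ε, hε, hb⟩ := hloc _ hzU
    have hev : ∀ᶠ z' in nhds z, (c z' ∈ A ↔ c z ∈ A) := by
      filter_upwards [hcc.continuousAt (Metric.ball_mem_nhds (c z) hε)] with z' hz'
      exact hb _ (hcQ z') hz'
    by_cases hzA : c z ∈ A
    · refine hz.2 (mem_interior_iff_mem_nhds.2 ?_)
      filter_upwards [hev] with z' hz' using hz'.2 hzA
    · obtain ⟨z', hz1, hz2⟩ := mem_closure_iff_nhds.1 hz.1 _ hev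
      exact hzA (hz1.1 hz2)
  obtain ⟨f, hf, hfe⟩ := exists_continuous_log hgc (fun z => by
    simp only [hg]; split_ifs <;> exact Complex.exp_ne_zero _)
  have e1 := sub_eq_sub_of_exp_eq (f := fun s => f (s, y₀))
    (g := fun s => h (c (s, y₀)) * Real.pi * Complex.I) (by fun_prop) (by fun_prop) (fun s => by
      rw [hfe]
      simp only [hg]
      split_ifs with hsA
      · rfl
      · refine (hK _ fun hsU => hsA ?_).symm
        exact ⟨_, hcb s, JoinedIn.refl hsU⟩) x₀ x₁
  have e2 := sub_eq_sub_of_exp_eq (f := fun s => f (s, y₁))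
    (g := fun s => -(h (c (s, y₁)) * Real.pi * Complex.I)) (by fun_prop) (by fun_prop) (fun s => by
      rw [hfe]
      simp only [hg]
      rw [if_neg fun hsA => htop _ hsA (hct s)]) x₀ x₁
  have hL : ∀ t, h (c (x₀, t)) = 0 := fun t => h0 (Or.inr ⟨hcl t, hcQ _⟩)
  have hR : ∀ t, h (c (x₁, t)) = 1 := fun t => h1 (Or.inr ⟨hcr t, hcQ _⟩)
  have e3 := sub_eq_sub_of_exp_eq (f := fun t => f (x₀, t)) (g := fun _ => 0) (by fun_prop)
    (by fun_prop) (fun t => by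
      rw [hfe]; simp [hg, hL]) y₀ y₁
  have e4 := sub_eq_sub_of_exp_eq (f := fun t => f (x₁, t)) (g := fun _ => Real.pi * Complex.I)
    (by fun_prop) (by fun_prop) (fun t => by
      rw [hfe]; simp [hg, hR, Complex.exp_neg, Complex.exp_pi_mul_I]) y₀ y₁
  simp only [hL, hR] at e1 e2 e3 e4
  -- A logarithm of `g` gains `π * I` along the bottom, loses `π * I` along the top and is constant
  -- on the vertical sides, so its total change around the rectangle would be `2 * π * I`.
  have key : (2 * Real.pi : ℂ) * Complex.I = 0 := by
    push_cast at e1 e2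
    linear_combination e3 - e4 - e1 + e2
  exact Complex.two_pi_I_ne_zero key

end Topology

/-! ### Geometry of Voronoi cells -/

section Cells

lemma norm_sub_sq (u x : Plane) : ‖u - x‖ ^ 2 = (u 0 - x 0) ^ 2 + (u 1 - x 1) ^ 2 := by
  simp [EuclideanSpace.norm_sq_eq, Fin.sum_univ_two]

lemma norm_sub_le_iff (u v x : Plane) : ‖u - x‖ ≤ ‖v - x‖ ↔
    (u 0 - x 0) ^ 2 + (u 1 - x 1) ^ 2 ≤ (v 0 - x 0) ^ 2 + (v 1 - x 1) ^ 2 := by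
  rw [← norm_sub_sq, ← norm_sub_sq, sq_le_sq₀ (norm_nonneg _) (norm_nonneg _)]

lemma norm_sub_lt_iff (u v x : Plane) : ‖u - x‖ < ‖v - x‖ ↔
    (u 0 - x 0) ^ 2 + (u 1 - x 1) ^ 2 < (v 0 - x 0) ^ 2 + (v 1 - x 1) ^ 2 := by
  rw [← norm_sub_sq, ← norm_sub_sq, sq_lt_sq₀ (norm_nonneg _) (norm_nonneg _)]

lemma norm_sub_eq_iff (u v x : Plane) : ‖u - x‖ = ‖v - x‖ ↔
    (u 0 - x 0) ^ 2 + (u 1 - x 1) ^ 2 = (v 0 - x 0) ^ 2 + (v 1 - x 1) ^ 2 := by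
  rw [← norm_sub_sq, ← norm_sub_sq, sq_eq_sq₀ (norm_nonneg _) (norm_nonneg _)]

variable {η : Set Plane}

lemma isClosed_cell (η : Set Plane) (u : Plane) : IsClosed (cell η u) := by
  have : cell η u = ⋂ v ∈ η, {x | ‖u - x‖ ≤ ‖v - x‖} := by ext x; simp [cell]
  rw [this]
  exact isClosed_biInter fun v _ => isClosed_le (by fun_prop) (by fun_prop)

lemma convex_cell (η : Set Plane) (u : Plane) : Convex ℝ (cell η u) := by
  intro x hx y hy a b ha hb hab v hv
  have h1 := (norm_sub_le_iff _ _ _).1 (hx v hv)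
  have h2 := (norm_sub_le_iff _ _ _).1 (hy v hv)
  rw [norm_sub_le_iff]
  obtain rfl : a = 1 - b := by linarith
  simp only [PiLp.add_apply, PiLp.smul_apply, smul_eq_mul]
  nlinarith [mul_le_mul_of_nonneg_left h1 ha, mul_le_mul_of_nonneg_left h2 hb]

lemma norm_eq_of_mem_cell {u v x : Plane} (hu : u ∈ η) (hv : v ∈ η) (h1 : x ∈ cell η u)
    (h2 : x ∈ cell η v) : ‖u - x‖ = ‖v - x‖ :=
  (h1 v hv).antisymm (h2 u hu)

lemma mem_cell_of_norm_le {u v x : Plane} (h1 : x ∈ cell η u) (h : ‖v - x‖ ≤ ‖u - x‖) :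
    x ∈ cell η v := fun w hw => h.trans (h1 w hw)

/-- A segment within a cell meets no cells but those of its end points. -/
lemma mem_cell_of_mem_segment {u v x y z : Plane} (hu : u ∈ η) (hv : v ∈ η) (hx : x ∈ cell η u)
    (hy : y ∈ cell η u) (hz : z ∈ segment ℝ x y) (hzv : z ∈ cell η v) :
    x ∈ cell η v ∨ y ∈ cell η v := by
  have hzu := (convex_cell η u).segment_subset hx hy hz
  have e := (norm_sub_eq_iff _ _ _).1 (norm_eq_of_mem_cell hu hv hzu hzv)
  have h1 := (norm_sub_le_iff _ _ _).1 (hx v hv)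
  have h2 := (norm_sub_le_iff _ _ _).1 (hy v hv)
  -- The difference of squared distances to `u` and `v` is affine along the segment; if it is
  -- strictly signed at both ends, it cannot vanish between them.
  by_contra! hcon
  have h1' : ‖u - x‖ < ‖v - x‖ := not_le.1 fun h => hcon.1 (mem_cell_of_norm_le hx h)
  have h2' : ‖u - y‖ < ‖v - y‖ := not_le.1 fun h => hcon.2 (mem_cell_of_norm_le hy h)
  rw [norm_sub_lt_iff] at h1' h2'
  obtain ⟨a, b, ha, hb, hab, rfl⟩ := hz
  obtain rfl : a = 1 - b := by linarith
  simp only [PiLp.add_apply, PiLp.smul_apply, smul_eq_mul] at e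
  rcases hb.eq_or_lt with rfl | hb
  · simp only [sub_zero, one_mul, zero_mul, add_zero] at e
    exact h1'.ne e
  · nlinarith [mul_le_mul_of_nonneg_left h1'.le ha, mul_lt_mul_of_pos_left h2' hb]

/-- A nonempty locally finite set of points. -/
structure LocFinite (η : Set Plane) : Prop where
  nonempty : η.Nonempty
  finite : ∀ r : ℝ, (η ∩ Metric.closedBall 0 r).Finite

lemma LocFinite.exists_mem_cell (h : LocFinite η) (x : Plane) : ∃ u ∈ η, x ∈ cell η u := by
  obtain ⟨v, hv⟩ := h.nonempty
  have hfin : (η ∩ Metric.closedBall x ‖v - x‖).Finite :=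
    (h.finite (‖x‖ + ‖v - x‖)).subset (Set.inter_subset_inter_right _ fun y hy => by
      rw [Metric.mem_closedBall, dist_eq_norm] at hy
      rw [mem_closedBall_zero_iff]
      calc ‖y‖ = ‖x + (y - x)‖ := by abel_nf
        _ ≤ _ := (norm_add_le _ _).trans (by linarith))
  obtain ⟨u, hu, hmin⟩ := Set.exists_min_image _ (fun u => ‖u - x‖) hfin
    ⟨v, hv, by simp [dist_eq_norm]⟩
  refine ⟨u, hu.1, fun w hw => ?_⟩
  by_cases hw' : ‖w - x‖ ≤ ‖v - x‖
  · exact hmin w ⟨hw, by simpa [dist_eq_norm] using hw'⟩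
  · have := hu.2
    rw [Metric.mem_closedBall, dist_eq_norm] at this
    exact this.trans (not_le.1 hw').le

lemma LocFinite.finite_cells (h : LocFinite η) {B : Set Plane} (hB : Bornology.IsBounded B) :
    {u | u ∈ η ∧ (cell η u ∩ B).Nonempty}.Finite := by
  obtain ⟨v, hv⟩ := h.nonempty
  obtain ⟨r, hr⟩ := hB.exists_norm_le
  refine (h.finite (‖v‖ + r + r)).subset ?_
  rintro u ⟨hu, x, hx, hxB⟩
  refine ⟨hu, ?_⟩
  rw [mem_closedBall_zero_iff]
  have h1 := hr x hxB
  have h2 := hx v hv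
  have h3 := norm_sub_le v x
  have h4 : ‖u‖ ≤ ‖u - x‖ + ‖x‖ := by simpa using norm_add_le (u - x) x
  linarith

/-- Near `x` there are only points of those cells that contain `x`. -/
lemma LocFinite.eventually_cell (h : LocFinite η) (x : Plane) :
    ∀ᶠ y in nhds x, ∀ u ∈ η, y ∈ cell η u → x ∈ cell η u := by
  have hfin := h.finite_cells (Metric.isBounded_ball (x := x) (r := 1))
  have hc : IsClosed (⋃ u ∈ {u | (u ∈ η ∧ (cell η u ∩ Metric.ball x 1).Nonempty) ∧ x ∉ cell η u},
      cell η u) :=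
    (hfin.subset fun u hu => hu.1).isClosed_biUnion fun u _ => isClosed_cell η u
  filter_upwards [hc.isOpen_compl.mem_nhds (by simp), Metric.ball_mem_nhds x one_pos] with y hy hyb
  intro u hu hyu
  by_contra hxu
  exact hy (Set.mem_biUnion (⟨⟨hu, y, hyu, hyb⟩, hxu⟩ : u ∈ {u | _ ∧ _}) hyu)

/-- The points of `η` whose cells meet the rectangle. -/
abbrev CellsIn (η : Set Plane) (x₀ x₁ y₀ y₁ : ℝ) : Type :=
  {u : η // (cell η u ∩ rect x₀ x₁ y₀ y₁).Nonempty}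

variable {x₀ x₁ y₀ y₁ : ℝ}

lemma isBounded_rect (x₀ x₁ y₀ y₁ : ℝ) : Bornology.IsBounded (rect x₀ x₁ y₀ y₁) := by
  rw [isBounded_iff_forall_norm_le]
  refine ⟨(|x₀| + |x₁|) + (|y₀| + |y₁|), fun p hp => ?_⟩
  have h0 : |p 0| ≤ |x₀| + |x₁| := abs_le.2
    ⟨by linarith [hp.1.1, neg_abs_le x₀, abs_nonneg x₁], by linarith [hp.1.2, le_abs_self x₁, abs_nonneg x₀]⟩
  have h1 : |p 1| ≤ |y₀| + |y₁| := abs_le.2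
    ⟨by linarith [hp.2.1, neg_abs_le y₀, abs_nonneg y₁], by linarith [hp.2.2, le_abs_self y₁, abs_nonneg y₀]⟩
  have h2 : ‖p‖ ≤ |p 0| + |p 1| := by
    refine abs_le_of_sq_le_sq' ?_ (by positivity) |>.2
    have := norm_sub_sq p 0
    simp only [sub_zero, PiLp.zero_apply] at this
    rw [this, ← sq_abs (p 0), ← sq_abs (p 1)]
    nlinarith [mul_nonneg (abs_nonneg (p 0)) (abs_nonneg (p 1))]
  linarith

lemma isCompact_rect (x₀ x₁ y₀ y₁ : ℝ) : IsCompact (rect x₀ x₁ y₀ y₁) :=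
  Metric.isCompact_of_isClosed_isBounded (isClosed_rect _ _ _ _) (isBounded_rect _ _ _ _)

lemma LocFinite.finite_cellsIn (h : LocFinite η) : Finite (CellsIn η x₀ x₁ y₀ y₁) := by
  have := (h.finite_cells (isBounded_rect x₀ x₁ y₀ y₁)).to_subtype
  exact Finite.of_injective
    (fun u : CellsIn η x₀ x₁ y₀ y₁ => (⟨u.1.1, u.1.2, u.2⟩ : {u | u ∈ η ∧ (cell η u ∩ rect x₀ x₁ y₀ y₁).Nonempty}))
    fun u v huv => by
      simp only [Subtype.mk.injEq] at huv
      exact Subtype.ext (Subtype.ext huv)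

/-- The cells met by a path. -/
def cellsOf (η : Set Plane) (x₀ x₁ y₀ y₁ : ℝ) (γ : C(unitInterval, Plane)) :
    Set (CellsIn η x₀ x₁ y₀ y₁) := {v | Meets η γ v.1}

/-- The crossing system of the cells of a rectangle. -/
def system (η : Set Plane) (x₀ x₁ y₀ y₁ : ℝ) : CrossingSystem (CellsIn η x₀ x₁ y₀ y₁) where
  r u v := u ≠ v ∧ ∃ p ∈ rect x₀ x₁ y₀ y₁, p ∈ cell η u.1 ∧ p ∈ cell η v.1
  left := {u | ∃ p ∈ rect x₀ x₁ y₀ y₁, p ∈ cell η u.1 ∧ p 0 = x₀}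
  right := {u | ∃ p ∈ rect x₀ x₁ y₀ y₁, p ∈ cell η u.1 ∧ p 0 = x₁}
  C := {δ | ∃ γ, IsVerticalCrossing x₀ x₁ y₀ y₁ γ ∧ δ = cellsOf η x₀ x₁ y₀ y₁ γ}

/-- A chain of cells gives rise to a path through these cells. -/
lemma joinedIn_of_reach {Z : Set Plane} {T : Set (CellsIn η x₀ x₁ y₀ y₁)}
    (h1 : ∀ v ∈ T, ∀ x ∈ cell η v.1, ∀ y ∈ cell η v.1, x ∈ Z → y ∈ Z → segment ℝ x y ⊆ Z)
    (h2 : ∀ v ∈ T, v ∈ (system η x₀ x₁ y₀ y₁).right → ∃ y ∈ cell η v.1, y ∈ Z ∧ y 0 = x₁)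
    (h3 : ∀ v ∈ T, ∀ w ∈ T, (system η x₀ x₁ y₀ y₁).r v w →
      ∃ z ∈ Z, z ∈ cell η v.1 ∧ z ∈ cell η w.1)
    {v : CellsIn η x₀ x₁ y₀ y₁} (h : (system η x₀ x₁ y₀ y₁).Reach T v) :
    ∀ x ∈ cell η v.1, x ∈ Z → ∃ y, y 0 = x₁ ∧ JoinedIn Z x y := by
  induction h with
  | base hT hr =>
    intro x hx hxZ
    obtain ⟨y, hy, hyZ, hy1⟩ := h2 _ hT hr
    exact ⟨y, hy1, JoinedIn.of_segment_subset (h1 _ hT x hx y hy hxZ hyZ)⟩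
  | step hT hr hw ih =>
    intro x hx hxZ
    obtain ⟨z, hz, hzv, hzw⟩ := h3 _ hT _ hw.mem hr
    obtain ⟨y, hy1, hj⟩ := ih z hzw hz
    exact ⟨y, hy1, (JoinedIn.of_segment_subset (h1 _ hT x hx z hzv hxZ hz)).trans hj⟩

lemma mem_cellsIn {γ : C(unitInterval, Plane)} (hγ : ∀ t, γ t ∈ rect x₀ x₁ y₀ y₁) {u : η}
    (h : Meets η γ u) : (cell η u ∩ rect x₀ x₁ y₀ y₁).Nonempty :=
  let ⟨t, ht⟩ := h
  ⟨γ t, ht, hγ t⟩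

theorem LocFinite.lawful (h : LocFinite η) (hx : x₀ < x₁) (hy : y₀ < y₁) :
    (system η x₀ x₁ y₀ y₁).Lawful where
  nonempty := by
    rintro _ ⟨γ, hγ, rfl⟩
    obtain ⟨u, hu, hc⟩ := h.exists_mem_cell (γ 0)
    exact ⟨⟨⟨u, hu⟩, γ 0, hc, hγ.1 0⟩, 0, hc⟩
  conn := by
    have := h.finite_cellsIn (x₀ := x₀) (x₁ := x₁) (y₀ := y₀) (y₁ := y₁)
    rintro _ ⟨γ, hγ, rfl⟩ U ⟨v, ⟨s, hs⟩, hvU⟩ hU w ⟨t, ht⟩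
    by_contra hwU
    have hcl : ∀ D : Set (CellsIn η x₀ x₁ y₀ y₁), IsClosed {t | ∃ u ∈ D, γ t ∈ cell η u.1} := by
      intro D
      have : {t | ∃ u ∈ D, γ t ∈ cell η u.1} = ⋃ u ∈ D, γ ⁻¹' cell η u.1 := by ext; simp
      rw [this]
      exact (Set.toFinite D).isClosed_biUnion fun u _ => (isClosed_cell η _).preimage γ.continuous
    -- The times spent in cells of `U` and in cells outside `U` form closed sets covering the
    -- interval. They share a time, at which two cells touch.
    obtain ⟨a, -, ⟨u, hu, hau⟩, ⟨u', hu', hau'⟩⟩ :=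
      isPreconnected_closed_iff.1 (isPreconnected_univ (α := unitInterval)) _ _ (hcl U) (hcl Uᶜ)
        (fun a _ => by
          obtain ⟨u, hu, hc⟩ := h.exists_mem_cell (γ a)
          by_cases hm : (⟨⟨u, hu⟩, γ a, hc, hγ.1 a⟩ : CellsIn η x₀ x₁ y₀ y₁) ∈ U
          · exact Or.inl ⟨_, hm, hc⟩
          · exact Or.inr ⟨_, hm, hc⟩)
        ⟨s, trivial, v, hvU, hs⟩ ⟨t, trivial, w, hwU, ht⟩
    exact hu' (hU u ⟨a, hau⟩ u' ⟨a, hau'⟩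
      ⟨fun e => hu' (e ▸ hu), γ a, hγ.1 a, hau', hau⟩ hu)
  blocks := by
    rintro _ ⟨γ, hγ, rfl⟩ v ⟨x, hxr, hxv, hx0⟩ hreach
    obtain ⟨y, hy1, hj⟩ := joinedIn_of_reach
      (Z := {x | x ∈ rect x₀ x₁ y₀ y₁ ∧ ∃ v ∉ cellsOf η x₀ x₁ y₀ y₁ γ, x ∈ cell η v.1})
      (fun v hv x hx y hy hxZ hyZ z hz => ⟨(convex_rect _ _ _ _).segment_subset hxZ.1 hyZ.1 hz, v, hv,
        (convex_cell _ _).segment_subset hx hy hz⟩)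
      (fun v hv ⟨p, hp, hpv, hp1⟩ => ⟨p, hpv, ⟨hp, v, hv, hpv⟩, hp1⟩)
      (fun v hv w _ ⟨_, p, hp, hpv, hpw⟩ => ⟨p, ⟨hp, v, hv, hpv⟩, hpv, hpw⟩)
      hreach x hxv ⟨hxr, v, hreach.mem, hxv⟩
    obtain ⟨s, t, hst⟩ := exists_eq_of_crossings (γ := hj.somePath.toContinuousMap) (δ := γ)
      ⟨fun t => (hj.somePath_mem t).1, by simpa using hx0, by simpa using hy1⟩ hγ
    obtain ⟨w, hw, hc⟩ := (hj.somePath_mem s).2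
    exact hw ⟨t, by rw [← hst]; exact hc⟩
  exists_of_blocks := by
    intro S hS
    have := h.finite_cellsIn (x₀ := x₀) (x₁ := x₁) (y₀ := y₀) (y₁ := y₁)
    set G := system η x₀ x₁ y₀ y₁ with hG
    have hcl : ∀ D : Set (CellsIn η x₀ x₁ y₀ y₁), IsClosed (⋃ u ∈ D, cell η u.1) := fun D =>
      (Set.toFinite D).isClosed_biUnion fun u _ => isClosed_cell η _
    -- The cells outside `S` are split by whether they reach the right side within `Sᶜ`. Touching
    -- cells would extend the chain, so the two unions are disjoint; a path avoiding both meets only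
    -- cells of `S`.
    obtain ⟨γ, hγ, hav⟩ := exists_vertical_avoiding hx hy
      (hcl {v | v ∉ S ∧ ¬ G.Reach Sᶜ v}) (hcl {v | G.Reach Sᶜ v})
      (fun p hp h1 h2 => by
        simp only [Set.mem_iUnion, Set.mem_ofPred_eq, exists_prop] at h1 h2
        obtain ⟨v, ⟨hvS, hv⟩, hpv⟩ := h1
        obtain ⟨w, hw, hpw⟩ := h2
        exact hv (.step hvS ⟨fun e => hv (e ▸ hw), p, hp, hpv, hpw⟩ hw))
      (fun p hp hp1 h1 => by
        simp only [Set.mem_iUnion, Set.mem_ofPred_eq, exists_prop] at h1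
        obtain ⟨v, ⟨hvS, hv⟩, hpv⟩ := h1
        exact hv (.base hvS ⟨p, hp, hpv, hp1⟩))
      (fun p hp hp1 h1 => by
        simp only [Set.mem_iUnion, Set.mem_ofPred_eq, exists_prop] at h1
        obtain ⟨v, hv, hpv⟩ := h1
        exact hS v ⟨p, hp, hpv, hp1⟩ hv)
    refine ⟨_, ⟨γ, hγ, rfl⟩, ?_⟩
    rintro v ⟨t, ht⟩
    by_contra hvS
    by_cases hv : G.Reach Sᶜ v
    · exact (hav t).2 (Set.mem_biUnion (show v ∈ {v | _} from hv) ht)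
    · exact (hav t).1 (Set.mem_biUnion (show v ∈ {v | _ ∧ _} from ⟨hvS, hv⟩) ht)

/-! ### General position and duality of crossings -/

/-- `η` is in general position with respect to the rectangle. -/
structure Generic (η : Set Plane) (x₀ x₁ y₀ y₁ : ℝ) : Prop extends LocFinite η where
  four : ∀ p ∈ rect x₀ x₁ y₀ y₁, ∀ a ∈ η, ∀ b ∈ η, ∀ c ∈ η, ∀ d ∈ η,
    a ≠ b → a ≠ c → a ≠ d → b ≠ c → b ≠ d → c ≠ d →
    ‖a - p‖ = ‖b - p‖ → ‖a - p‖ = ‖c - p‖ → ‖a - p‖ = ‖d - p‖ → False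
  three : ∀ p ∈ rect x₀ x₁ y₀ y₁, (p 0 = x₀ ∨ p 0 = x₁ ∨ p 1 = y₀ ∨ p 1 = y₁) →
    ∀ a ∈ η, ∀ b ∈ η, ∀ c ∈ η, a ≠ b → a ≠ c → b ≠ c →
    ‖a - p‖ = ‖b - p‖ → ‖a - p‖ = ‖c - p‖ → False
  two : ∀ p : Plane, (p 0 = x₀ ∨ p 0 = x₁) → (p 1 = y₀ ∨ p 1 = y₁) →
    ∀ a ∈ η, ∀ b ∈ η, a ≠ b → ‖a - p‖ = ‖b - p‖ → False
  coord : ∀ i, ∀ a ∈ η, ∀ b ∈ η, a ≠ b → a i ≠ b i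

/-- Three distinct points of a circle are not collinear. With `u` at the origin, `a = v`, `b = w`,
collinearity gives `a · b = |a|² = |b|²`, hence `|a - b|² = 0`. -/
lemma cross_ne_zero {u v w p : Plane} (huv : u ≠ v) (huw : u ≠ w) (hvw : v ≠ w)
    (h1 : ‖u - p‖ = ‖v - p‖) (h2 : ‖u - p‖ = ‖w - p‖) :
    (w 0 - u 0) * (v 1 - u 1) - (w 1 - u 1) * (v 0 - u 0) ≠ 0 := by
  rw [norm_sub_eq_iff] at h1 h2
  intro h
  have hne : ∀ {a b : Plane}, a ≠ b → 0 < (a 0 - b 0) ^ 2 + (a 1 - b 1) ^ 2 := fun {a b} hab => by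
    rw [← norm_sub_sq]; exact pow_pos (norm_pos_iff.2 (sub_ne_zero.2 hab)) 2
  have q1 := hne huv
  have q2 := hne huw
  have q3 := hne hvw
  obtain ⟨a0, ha0⟩ : ∃ a, a = v 0 - u 0 := ⟨_, rfl⟩
  obtain ⟨a1, ha1⟩ : ∃ a, a = v 1 - u 1 := ⟨_, rfl⟩
  obtain ⟨b0, hb0⟩ : ∃ a, a = w 0 - u 0 := ⟨_, rfl⟩
  obtain ⟨b1, hb1⟩ : ∃ a, a = w 1 - u 1 := ⟨_, rfl⟩
  obtain ⟨c0, hc0⟩ : ∃ a, a = p 0 - u 0 := ⟨_, rfl⟩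
  obtain ⟨c1, hc1⟩ : ∃ a, a = p 1 - u 1 := ⟨_, rfl⟩
  have ev0 : v 0 = u 0 + a0 := by linarith
  have ev1 : v 1 = u 1 + a1 := by linarith
  have ew0 : w 0 = u 0 + b0 := by linarith
  have ew1 : w 1 = u 1 + b1 := by linarith
  have ep0 : p 0 = u 0 + c0 := by linarith
  have ep1 : p 1 = u 1 + c1 := by linarith
  rw [ev0, ev1, ep0, ep1] at h1
  rw [ew0, ew1, ep0, ep1] at h2
  rw [ev0, ev1, ew0, ew1] at h q3
  rw [ev0, ev1] at q1
  rw [ew0, ew1] at q2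
  clear ha0 ha1 hb0 hb1 hc0 hc1 ev0 ev1 ew0 ew1 ep0 ep1 hne
  have hA : a0 ^ 2 + a1 ^ 2 = 2 * (a0 * c0 + a1 * c1) := by linear_combination -h1
  have hB : b0 ^ 2 + b1 ^ 2 = 2 * (b0 * c0 + b1 * c1) := by linear_combination -h2
  have hX : b0 * a1 = b1 * a0 := by linear_combination h
  have e1 : (b0 ^ 2 + b1 ^ 2) * (a0 * b0 + a1 * b1) = (b0 ^ 2 + b1 ^ 2) * (a0 ^ 2 + a1 ^ 2) := by
    linear_combination (a0 * b0 + a1 * b1) * hB - (b0 ^ 2 + b1 ^ 2) * hA +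
      (2 * c0 * b1 - 2 * c1 * b0) * hX
  have e2 : (a0 ^ 2 + a1 ^ 2) * (a0 * b0 + a1 * b1) = (a0 ^ 2 + a1 ^ 2) * (b0 ^ 2 + b1 ^ 2) := by
    linear_combination (a0 * b0 + a1 * b1) * hA - (a0 ^ 2 + a1 ^ 2) * hB +
      (2 * c1 * a0 - 2 * c0 * a1) * hX
  have n1 : b0 ^ 2 + b1 ^ 2 ≠ 0 := by ring_nf at q2 ⊢; exact q2.ne'
  have n2 : a0 ^ 2 + a1 ^ 2 ≠ 0 := by ring_nf at q1 ⊢; exact q1.ne'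
  have f1 := mul_left_cancel₀ n1 e1
  have f2 := mul_left_cancel₀ n2 e2
  linarith

lemma tendsto_line (p n : Plane) :
    Filter.Tendsto (fun t : ℝ => p + t • n) (nhdsWithin 0 (Set.Ioi 0)) (nhds p) := by
  have : Continuous fun t : ℝ => p + t • n := by fun_prop
  simpa using (this.tendsto 0).mono_left nhdsWithin_le_nhds

/-- At most three cells meet at `p`. A small move along the bisector of `u` and `v`, away from the
third point, leaves only these two. -/
lemma Generic.exists_mem_two (h : Generic η x₀ x₁ y₀ y₁) {u v p : Plane} (hu : u ∈ η) (hv : v ∈ η)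
    (huv : u ≠ v) (hp : p ∈ rect x₀ x₁ y₀ y₁) (hpu : p ∈ cell η u) (hpv : p ∈ cell η v) :
    ∃ z ∈ rect x₀ x₁ y₀ y₁, z ∈ cell η u ∧ z ∈ cell η v ∧
      ∀ w ∈ η, z ∈ cell η w → w = u ∨ w = v := by
  by_cases hex : ∃ w ∈ η, p ∈ cell η w ∧ w ≠ u ∧ w ≠ v
  swap
  · push Not at hex
    exact ⟨p, hp, hpu, hpv, fun w hw hpw => or_iff_not_imp_left.2 (hex w hw hpw)⟩
  obtain ⟨w, hw, hpw, hwu, hwv⟩ := hex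
  have euv := norm_eq_of_mem_cell hu hv hpu hpv
  have euw := norm_eq_of_mem_cell hu hw hpu hpw
  have hside : ¬(p 0 = x₀ ∨ p 0 = x₁ ∨ p 1 = y₀ ∨ p 1 = y₁) := fun hs =>
    h.three p hp hs u hu v hv w hw huv hwu.symm hwv.symm euv euw
  push Not at hside
  set D := (w 0 - u 0) * (v 1 - u 1) - (w 1 - u 1) * (v 0 - u 0) with hD
  have hD0 : D ≠ 0 := cross_ne_zero huv hwu.symm hwv.symm euv euw
  -- Normal to `v - u`; the factor `D` fixes the sign, so that moving by `t • n` increases the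
  -- squared distance to `w` by `2 * t * D ^ 2` relative to `u`.
  set n : Plane := !₂[-D * (v 1 - u 1), D * (v 0 - u 0)] with hn
  have ht := tendsto_line p n
  have hrect : rect x₀ x₁ y₀ y₁ ∈ nhds p := by
    have : IsOpen {q : Plane | (q 0 ∈ Set.Ioo x₀ x₁) ∧ q 1 ∈ Set.Ioo y₀ y₁} :=
      (isOpen_Ioo.preimage (by fun_prop : Continuous fun p : Plane => p 0)).inter
        (isOpen_Ioo.preimage (by fun_prop : Continuous fun p : Plane => p 1))
    refine Filter.mem_of_superset (this.mem_nhds ?_) fun q hq =>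
      ⟨Set.Ioo_subset_Icc_self hq.1, Set.Ioo_subset_Icc_self hq.2⟩
    exact ⟨⟨lt_of_le_of_ne hp.1.1 hside.1.symm, lt_of_le_of_ne hp.1.2 hside.2.1⟩,
      ⟨lt_of_le_of_ne hp.2.1 hside.2.2.1.symm, lt_of_le_of_ne hp.2.2 hside.2.2.2⟩⟩
  obtain ⟨t, ⟨ht1, ht2⟩, ht0⟩ := (((ht.eventually hrect).and
    (ht.eventually (h.eventually_cell p))).and self_mem_nhdsWithin).exists
  set z := p + t • n with hz
  have hz0 : z 0 = p 0 - t * D * (v 1 - u 1) := by simp [hz, hn]; ring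
  have hz1 : z 1 = p 1 + t * D * (v 0 - u 0) := by simp [hz, hn]; ring
  have hzuv : ‖u - z‖ = ‖v - z‖ := by
    rw [norm_sub_eq_iff] at euv ⊢
    rw [hz0, hz1]; linear_combination euv
  have hzuw : ‖u - z‖ < ‖w - z‖ := by
    rw [norm_sub_eq_iff] at euw
    rw [norm_sub_lt_iff, hz0, hz1]
    have hpos : 0 < t * (D * D) := mul_pos ht0 (mul_self_pos.2 hD0)
    have e : (w 0 - (p 0 - t * D * (v 1 - u 1))) ^ 2 + (w 1 - (p 1 + t * D * (v 0 - u 0))) ^ 2 -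
        ((u 0 - (p 0 - t * D * (v 1 - u 1))) ^ 2 + (u 1 - (p 1 + t * D * (v 0 - u 0))) ^ 2) =
        2 * (t * (D * D)) := by
      have hD' : t * (D * D) = t * D * ((w 0 - u 0) * (v 1 - u 1) - (w 1 - u 1) * (v 0 - u 0)) := by
        rw [← hD]; ring
      rw [hD']; linear_combination -euw
    linarith
  have honly : ∀ a ∈ η, z ∈ cell η a → a = u ∨ a = v := by
    intro a ha hza
    by_contra! hne
    have haw : a ≠ w := by
      rintro rfl; exact absurd (hza u hu) (not_le.2 hzuw)
    exact h.four p hp u hu v hv w hw a ha huv hwu.symm hne.1.symm hwv.symm hne.2.symm haw.symm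
      euv euw (norm_eq_of_mem_cell hu ha hpu (ht2 a ha hza))
  obtain ⟨a, ha, hza⟩ := h.exists_mem_cell z
  have : z ∈ cell η u ∧ z ∈ cell η v := by
    rcases honly a ha hza with rfl | rfl
    · exact ⟨hza, mem_cell_of_norm_le hza hzuv.ge⟩
    · exact ⟨mem_cell_of_norm_le hza hzuv.le, hza⟩
  exact ⟨z, ht1, this.1, this.2, honly⟩

/-- The same on a vertical side, where at most two cells meet at `p`: a small move along the side,
towards `u`, leaves `w`. It is possible since `p` is not a corner and `u`, `w` differ in height. -/
lemma Generic.exists_mem_one (h : Generic η x₀ x₁ y₀ y₁) {u p : Plane} (hu : u ∈ η)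
    (hp : p ∈ rect x₀ x₁ y₀ y₁) (hp0 : p 0 = x₀ ∨ p 0 = x₁) (hpu : p ∈ cell η u) :
    ∃ z ∈ rect x₀ x₁ y₀ y₁, z 0 = p 0 ∧ z ∈ cell η u ∧ ∀ w ∈ η, z ∈ cell η w → w = u := by
  by_cases hex : ∃ w ∈ η, p ∈ cell η w ∧ w ≠ u
  swap
  · push Not at hex
    exact ⟨p, hp, rfl, hpu, hex⟩
  obtain ⟨w, hw, hpw, hwu⟩ := hex
  have euw := norm_eq_of_mem_cell hu hw hpu hpw
  have hside : ¬(p 1 = y₀ ∨ p 1 = y₁) := fun hs => h.two p hp0 hs u hu w hw hwu.symm euw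
  push Not at hside
  have hD0 : u 1 - w 1 ≠ 0 := sub_ne_zero.2 (h.coord 1 u hu w hw hwu.symm)
  set n : Plane := !₂[0, u 1 - w 1] with hn
  have ht := tendsto_line p n
  have hrect : {q : Plane | q 1 ∈ Set.Ioo y₀ y₁} ∈ nhds p :=
    (isOpen_Ioo.preimage (by fun_prop : Continuous fun p : Plane => p 1)).mem_nhds
      ⟨lt_of_le_of_ne hp.2.1 hside.1.symm, lt_of_le_of_ne hp.2.2 hside.2⟩
  obtain ⟨t, ⟨ht1, ht2⟩, ht0⟩ := (((ht.eventually hrect).and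
    (ht.eventually (h.eventually_cell p))).and self_mem_nhdsWithin).exists
  set z := p + t • n with hz
  have hz0 : z 0 = p 0 := by simp [hz, hn]
  have hz1 : z 1 = p 1 + t * (u 1 - w 1) := by simp [hz, hn]
  have hzuw : ‖u - z‖ < ‖w - z‖ := by
    rw [norm_sub_eq_iff] at euw
    rw [norm_sub_lt_iff, hz0, hz1]
    have hpos : 0 < t * ((u 1 - w 1) * (u 1 - w 1)) := mul_pos ht0 (mul_self_pos.2 hD0)
    linarith
  have honly : ∀ a ∈ η, z ∈ cell η a → a = u := by
    intro a ha hza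
    by_contra hne
    have haw : w ≠ a := by
      rintro rfl; exact absurd (hza u hu) (not_le.2 hzuw)
    exact h.three p hp (hp0.imp id Or.inl) u hu w hw a ha hwu.symm (Ne.symm hne) haw
      euw (norm_eq_of_mem_cell hu ha hpu (ht2 a ha hza))
  obtain ⟨a, ha, hza⟩ := h.exists_mem_cell z
  exact ⟨z, ⟨by rw [hz0]; exact hp.1, Set.Ioo_subset_Icc_self ht1⟩, hz0, honly a ha hza ▸ hza, honly⟩

/-- The restriction of a colouring to the cells meeting the rectangle. -/
def restrictCol (η : Set Plane) (x₀ x₁ y₀ y₁ : ℝ) (ω : Colouring η) :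
    CellsIn η x₀ x₁ y₀ y₁ → Bool := fun v => ω v.1

lemma crossingCounts_eq (η : Set Plane) (x₀ x₁ y₀ y₁ : ℝ) (ω : Colouring η) :
    crossingCounts η ω x₀ x₁ y₀ y₁ =
      (system η x₀ x₁ y₀ y₁).counts Set.univ (restrictCol η x₀ x₁ y₀ y₁ ω) := by
  ext m
  constructor
  · rintro ⟨γ, hγ, hd⟩
    refine ⟨fun i => cellsOf η x₀ x₁ y₀ y₁ (γ i), fun i => ?_, fun i j hij => ?_⟩
    · obtain ⟨c, hc⟩ := (hγ i).2
      exact ⟨c, ⟨γ i, (hγ i).1, rfl⟩, Set.subset_univ _, fun v hv => hc v.1 hv⟩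
    · exact Set.disjoint_left.2 fun v h1 h2 => hd i j hij v.1 ⟨h1, h2⟩
  · rintro ⟨δ, hδ, hd⟩
    choose c hc using hδ
    choose γ hγ using fun i => (hc i).1
    have hm : ∀ i u (hu : Meets η (γ i) u) h, (⟨u, h⟩ : CellsIn η x₀ x₁ y₀ y₁) ∈ δ i :=
      fun i u hu h => by rw [(hγ i).2]; exact hu
    refine ⟨γ, fun i => ⟨(hγ i).1, c i, fun u hu => ?_⟩, fun i j hij u hu => ?_⟩
    · exact (hc i).2.2 ⟨u, mem_cellsIn (hγ i).1.1 hu⟩ (hm i u hu _)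
    · exact Set.disjoint_left.1 (hd i j hij) (hm i u hu.1 (mem_cellsIn (hγ i).1.1 hu.1))
        (hm j u hu.2 _)

/-- There is a red horizontal crossing if and only if there is no blue vertical crossing. -/
lemma Generic.mem_redCrossing_iff (h : Generic η x₀ x₁ y₀ y₁) (hx : x₀ < x₁) (hy : y₀ < y₁)
    (ω : Colouring η) : ω ∈ redCrossing η x₀ x₁ y₀ y₁ ↔
      (system η x₀ x₁ y₀ y₁).NoCol Set.univ false (restrictCol η x₀ x₁ y₀ y₁ ω) := by
  constructor
  · rintro ⟨γ, hγ, hred⟩ _ ⟨⟨δ, hδ, rfl⟩, -, hblue⟩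
    obtain ⟨s, t, hst⟩ := exists_eq_of_crossings hγ hδ
    obtain ⟨u, hu, hc⟩ := h.exists_mem_cell (γ s)
    have h1 := hred ⟨u, hu⟩ ⟨s, hc⟩
    have h2 := hblue ⟨⟨u, hu⟩, γ s, hc, hγ.1 s⟩ ⟨t, by rw [← hst]; exact hc⟩
    simp only [restrictCol] at h2
    simp [h1] at h2
  · intro hno
    set ω' := restrictCol η x₀ x₁ y₀ y₁ ω with hω'
    have hex : ∃ v ∈ (system η x₀ x₁ y₀ y₁).left,
        (system η x₀ x₁ y₀ y₁).Reach {v | ω' v = false}ᶜ v := by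
      by_contra! hcon
      obtain ⟨δ, hδ, hs⟩ := (h.lawful hx hy).exists_of_blocks _ hcon
      exact hno δ ⟨hδ, Set.subset_univ _, fun v hv => hs hv⟩
    have hT : ∀ v, v ∈ {v | ω' v = false}ᶜ → ω v.1 = true := fun v hv => by
      simpa [hω', restrictCol] using hv
    obtain ⟨v, ⟨p, hp, hpv, hp0⟩, hreach⟩ := hex
    obtain ⟨x, hxr, hx0, hxv, hxo⟩ := h.exists_mem_one v.1.2 hp (Or.inl hp0) hpv
    obtain ⟨y, hy1, hj⟩ := joinedIn_of_reach
      -- Every cell at a point of `Z` must be red, not just one of them; this is why the endpoints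
      -- and transition points come from `exists_mem_one` and `exists_mem_two`.
      (Z := {x | x ∈ rect x₀ x₁ y₀ y₁ ∧ ∀ u : η, x ∈ cell η u → ω u = true})
      (fun v _ x hx y hy hxZ hyZ z hz => ⟨(convex_rect _ _ _ _).segment_subset hxZ.1 hyZ.1 hz,
        fun u hu => (mem_cell_of_mem_segment v.1.2 u.2 hx hy hz hu).elim (hxZ.2 u) (hyZ.2 u)⟩)
      (fun v hv ⟨p, hp, hpv, hp1⟩ => by
        obtain ⟨z, hzr, hz0, hzv, hzo⟩ := h.exists_mem_one v.1.2 hp (Or.inr hp1) hpv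
        refine ⟨z, hzv, ⟨hzr, fun u hu => ?_⟩, hz0.trans hp1⟩
        rw [Subtype.ext (hzo u u.2 hu)]; exact hT v hv)
      (fun v hv w hw ⟨hvw, p, hp, hpv, hpw⟩ => by
        obtain ⟨z, hzr, hzv, hzw, hzo⟩ := h.exists_mem_two v.1.2 w.1.2
          (fun e => hvw (Subtype.ext (Subtype.ext e))) hp hpv hpw
        refine ⟨z, ⟨hzr, fun u hu => ?_⟩, hzv, hzw⟩
        rcases hzo u u.2 hu with e | e
        · rw [Subtype.ext e]; exact hT v hv
        · rw [Subtype.ext e]; exact hT w hw)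
      hreach x hxv ⟨hxr, fun u hu => by rw [Subtype.ext (hxo u u.2 hu)]; exact hT v hreach.mem⟩
    refine ⟨hj.somePath.toContinuousMap,
      ⟨fun t => (hj.somePath_mem t).1, by simpa [hx0] using hp0, by simpa using hy1⟩, ?_⟩
    rintro u ⟨t, ht⟩
    exact (hj.somePath_mem t).2 u ht

end Cells

/-! ### Almost sure general position of the Poisson process -/

section Poisson

variable {Ω : Type*} [MeasurableSpace Ω] {P : Measure Ω} {η : Ω → Set Plane}

lemma IsPoissonProcess.measure_count (hη : IsPoissonProcess P η) {A : Set Plane}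
    (hA : MeasurableSet A) (hA' : volume A < ⊤) (S : Set ℕ∞) :
    P {w | (η w ∩ A).encard ∈ S} =
      poissonMeasure (volume A).toNNReal {k : ℕ | (k : ℕ∞) ∈ S} := by
  have hS : MeasurableSet S := S.to_countable.measurableSet
  have : P.map (fun w => (η w ∩ A).encard) S =
      (poissonMeasure (volume A).toNNReal).map (fun k : ℕ => (k : ℕ∞)) S := by
    rw [hη.law_count A hA hA']
  rw [Measure.map_apply (hη.measurable_count A hA hA') hS,
    Measure.map_apply (by fun_prop) hS] at this
  exact this

/-- This is `1 - exp (-a) ≤ a`. -/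
lemma IsPoissonProcess.measure_count_ne_zero_le (hη : IsPoissonProcess P η) {A : Set Plane}
    (hA : MeasurableSet A) (hA' : volume A < ⊤) :
    P {w | (η w ∩ A).encard ≠ 0} ≤ volume A := by
  have h := hη.measure_count hA hA' {0}ᶜ
  have e : {k : ℕ | (k : ℕ∞) ∈ ({0}ᶜ : Set ℕ∞)} = {0}ᶜ := by ext; simp
  rw [e, prob_compl_eq_one_sub (by measurability), poissonMeasure_singleton] at h
  refine h.trans_le ?_
  rw [tsub_le_iff_right]
  nth_rewrite 1 [← ENNReal.ofReal_toReal hA'.ne]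
  rw [← ENNReal.ofReal_add (by positivity) (by positivity), ← ENNReal.ofReal_one]
  refine ENNReal.ofReal_le_ofReal ?_
  have := Real.add_one_le_exp (-(volume A).toReal)
  simp only [pow_zero, mul_one, Nat.factorial_zero, Nat.cast_one, div_one]
  change 1 ≤ (volume A).toReal + Real.exp (-(volume A).toReal)
  linarith

lemma IsPoissonProcess.ae_locFinite (hη : IsPoissonProcess P η) :
    ∀ᵐ w ∂P, LocFinite (η w) := by
  have hfin : ∀ r : ℝ, volume (Metric.closedBall (0 : Plane) r) < ⊤ := fun r =>
    measure_closedBall_lt_top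
  have hne : ∀ᵐ w ∂P, (η w).Nonempty := by
    have hb : ∀ n : ℕ, P {w | ¬ (η w).Nonempty} ≤
        ENNReal.ofReal (Real.exp (-(Real.pi * (n : ℝ) ^ 2))) := by
      intro n
      have h := hη.measure_count Metric.isClosed_closedBall.measurableSet (hfin n) {0}
      have e : {k : ℕ | (k : ℕ∞) ∈ ({0} : Set ℕ∞)} = {0} := by ext; simp
      rw [e, poissonMeasure_singleton] at h
      refine (measure_mono fun w hw => ?_).trans (h.trans_le ?_)
      · have : η w = ∅ := Set.not_nonempty_iff_eq_empty.1 hw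
        simp [this]
      · refine ENNReal.ofReal_le_ofReal (le_of_eq ?_)
        have hv : ((volume (Metric.closedBall (0 : Plane) (n : ℝ))).toNNReal : ℝ) =
            Real.pi * (n : ℝ) ^ 2 := by
          rw [EuclideanSpace.volume_closedBall_fin_two, ENNReal.coe_toNNReal_eq_toReal,
            ENNReal.toReal_mul, ENNReal.toReal_pow, ENNReal.toReal_ofReal (by positivity),
            ENNReal.toReal_ofReal Real.pi_pos.le, mul_comm]
        rw [hv]; simp
    have hlim : Filter.Tendsto
        (fun n : ℕ => ENNReal.ofReal (Real.exp (-(Real.pi * (n : ℝ) ^ 2)))) Filter.atTop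
        (nhds 0) := by
      rw [← ENNReal.ofReal_zero]
      refine ENNReal.tendsto_ofReal (Real.tendsto_exp_neg_atTop_nhds_zero.comp ?_)
      exact ((Filter.tendsto_pow_atTop two_ne_zero).comp
        tendsto_natCast_atTop_atTop).const_mul_atTop Real.pi_pos
    exact le_antisymm (ge_of_tendsto' hlim hb) zero_le
  have hf : ∀ᵐ w ∂P, ∀ n : ℕ, (η w ∩ Metric.closedBall 0 (n : ℝ)).Finite := by
    rw [ae_all_iff]
    intro n
    have h := hη.measure_count Metric.isClosed_closedBall.measurableSet (hfin n) {⊤}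
    have e : {k : ℕ | (k : ℕ∞) ∈ ({⊤} : Set ℕ∞)} = ∅ := by ext; simp
    rw [e, measure_empty] at h
    refine measure_mono_null (fun w hw => ?_) h
    exact Set.encard_eq_top_iff.2 hw
  filter_upwards [hne, hf] with w h1 h2
  refine ⟨h1, fun r => ?_⟩
  obtain ⟨n, hn⟩ := exists_nat_ge r
  exact (h2 n).subset (Set.inter_subset_inter_right _ (Metric.closedBall_subset_closedBall hn))

/-- The index of the square of side `1 / (n + 1)` containing a point. -/
noncomputable def gridIndex (n : ℕ) (p : Plane) : Fin 2 → ℤ := fun i => ⌊((n : ℝ) + 1) * p i⌋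

lemma measurable_gridIndex (n : ℕ) : Measurable (gridIndex n) :=
  measurable_pi_lambda _ fun i => by unfold gridIndex; fun_prop

lemma dist_le_of_gridIndex_eq {n : ℕ} {p q : Plane} (h : gridIndex n p = gridIndex n q) :
    dist p q ≤ 2 / (n + 1) := by
  have hn : (0 : ℝ) < n + 1 := by positivity
  have hi : ∀ i, |p i - q i| ≤ 1 / (n + 1) := fun i => by
    have := Int.abs_sub_lt_one_of_floor_eq_floor (congrFun h i)
    rw [← mul_sub, abs_mul, abs_of_pos hn] at this
    rw [le_div_iff₀ hn]; linarith
  rw [dist_eq_norm]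
  refine abs_le_of_sq_le_sq' ?_ (by positivity) |>.2
  rw [norm_sub_sq, ← sq_abs (p 0 - q 0), ← sq_abs (p 1 - q 1)]
  have h0 := pow_le_pow_left₀ (abs_nonneg _) (hi 0) 2
  have h1 := pow_le_pow_left₀ (abs_nonneg _) (hi 1) 2
  have e : (2 / (n + 1) : ℝ) ^ 2 = 4 * (1 / (n + 1)) ^ 2 := by ring
  have : 0 ≤ (1 / (n + 1) : ℝ) ^ 2 := by positivity
  linarith

/-- Separated points occupy different squares of the grid. Independence bounds the probability that
all these squares are occupied by the product of their areas, the volume of a box of tuples; the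
boxes meeting `N` are disjoint and lie in the thickening. -/
lemma IsPoissonProcess.measure_tuple_le (hη : IsPoissonProcess P η) {k : ℕ}
    {N : Set (Fin k → Plane)} {δ : ℝ} (hsep : ∀ t ∈ N, ∀ i j, i ≠ j → δ ≤ dist (t i) (t j))
    {n : ℕ} (hn : 2 / ((n : ℝ) + 1) < δ) :
    P {w | ∃ t ∈ N, ∀ i, t i ∈ η w} ≤ volume (Metric.cthickening (2 / ((n : ℝ) + 1)) N) := by
  set fl : (Fin k → Plane) → (Fin k → Fin 2 → ℤ) := fun t i => gridIndex n (t i) with hfl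
  set box : (Fin 2 → ℤ) → Set Plane := fun z => gridIndex n ⁻¹' {z} with hbox
  have hboxm : ∀ z, MeasurableSet (box z) := fun z =>
    measurable_gridIndex n (measurableSet_singleton z)
  have hboxf : ∀ z, volume (box z) < ⊤ := fun z =>
    (Metric.isBounded_iff.2 ⟨2 / (n + 1), fun p hp q hq =>
      dist_le_of_gridIndex_eq (hp.trans hq.symm)⟩).measure_lt_top
  set Z := fl '' N with hZ
  have hinj : ∀ z ∈ Z, ∀ i j, i ≠ j → z i ≠ z j := by
    rintro _ ⟨t, ht, rfl⟩ i j hij h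
    have h1 := dist_le_of_gridIndex_eq h
    linarith [hsep t ht i j hij]
  have hpi : ∀ z, Set.univ.pi (fun i => box (z i)) = fl ⁻¹' {z} := fun z => by
    ext t; simp [hbox, hfl, funext_iff]
  have hpim : ∀ z : Fin k → Fin 2 → ℤ, MeasurableSet (Set.univ.pi fun i => box (z i)) :=
    fun z => .univ_pi fun i => hboxm _
  calc P {w | ∃ t ∈ N, ∀ i, t i ∈ η w}
      ≤ P (⋃ z ∈ Z, ⋂ i, (fun w => (η w ∩ box (z i)).encard) ⁻¹' {0}ᶜ) := by
        refine measure_mono ?_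
        rintro w ⟨t, ht, hw⟩
        refine Set.mem_biUnion (Set.mem_image_of_mem fl ht) (Set.mem_iInter.2 fun i => ?_)
        simp only [Set.mem_preimage, Set.mem_compl_iff, Set.mem_singleton_iff, Set.encard_eq_zero]
        exact Set.Nonempty.ne_empty ⟨t i, hw i, rfl⟩
    _ ≤ ∑' z : Z, P (⋂ i, (fun w => (η w ∩ box (z.1 i)).encard) ⁻¹' {0}ᶜ) :=
        measure_biUnion_le _ Z.to_countable _
    _ ≤ ∑' z : Z, volume (Set.univ.pi fun i => box (z.1 i)) := by
        refine ENNReal.tsum_le_tsum fun z => ?_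
        have hind := hη.indep_count k (fun i => box (z.1 i)) (fun i => hboxm _) (fun i => hboxf _)
          (fun i j hij => Set.disjoint_left.2 fun p hp hq =>
            hinj z.1 z.2 i j hij (hp.symm.trans hq))
        have := hind.measure_inter_preimage_eq_mul Finset.univ
          (sets := fun _ => ({0}ᶜ : Set ℕ∞)) (fun i _ => (Set.to_countable _).measurableSet)
        simp only [Finset.mem_univ, Set.iInter_true] at this
        rw [this, volume_pi_pi]
        exact Finset.prod_le_prod' fun i _ => hη.measure_count_ne_zero_le (hboxm _) (hboxf _)
    _ = volume (⋃ z ∈ Z, Set.univ.pi fun i => box (z i)) := by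
        refine (measure_biUnion Z.to_countable (fun z _ z' _ hzz' => ?_)
          fun z _ => hpim z).symm
        simp only [Function.onFun, hpi]
        exact Set.disjoint_left.2 fun t h1 h2 => hzz' (h1.symm.trans h2)
    _ ≤ _ := by
        refine measure_mono (Set.iUnion₂_subset ?_)
        rintro _ ⟨t, ht, rfl⟩ s hs
        rw [hpi] at hs
        refine Metric.mem_cthickening_of_dist_le s t _ _ ht ?_
        exact (dist_pi_le_iff (by positivity)).2 fun i => dist_le_of_gridIndex_eq (congrFun hs i)

/-- Almost surely no tuple of distinct points of the process lies in a given closed null set. -/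
theorem IsPoissonProcess.ae_notMem (hη : IsPoissonProcess P η) {k : ℕ}
    {N : Set (Fin k → Plane)} (hN : IsClosed N) (h0 : volume N = 0) :
    ∀ᵐ w ∂P, ∀ t : Fin k → Plane, Function.Injective t → (∀ i, t i ∈ η w) → t ∉ N := by
  -- Compact pieces with separated entries: the volumes of their thickenings tend to the volume of
  -- the piece, which is 0.
  set M : ℕ → Set (Fin k → Plane) := fun m => {t | t ∈ N ∧ ‖t‖ ≤ m ∧
    ∀ i j, i ≠ j → 1 / ((m : ℝ) + 1) ≤ dist (t i) (t j)} with hM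
  have hMc : ∀ m, IsClosed (M m) := fun m => by
    have : M m = N ∩ ({t | ‖t‖ ≤ m} ∩ ⋂ i, ⋂ j, ⋂ _ : i ≠ j,
        {t | 1 / ((m : ℝ) + 1) ≤ dist (t i) (t j)}) := by ext; simp [hM]; tauto
    rw [this]
    exact hN.inter ((isClosed_le (by fun_prop) (by fun_prop)).inter
      (isClosed_iInter fun i => isClosed_iInter fun j => isClosed_iInter fun _ =>
        isClosed_le (by fun_prop) (by fun_prop)))
  have hMk : ∀ m, IsCompact (M m) := fun m =>
    (isCompact_closedBall (0 : Fin k → Plane) m).of_isClosed_subset (hMc m)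
      fun t ht => mem_closedBall_zero_iff.2 ht.2.1
  have hdec : Filter.Tendsto (fun n : ℕ => (2 : ℝ) / (n + 1)) Filter.atTop (nhds 0) := by
    have := (tendsto_one_div_add_atTop_nhds_zero_nat (𝕜 := ℝ)).const_mul 2
    simpa [div_eq_mul_inv] using this
  have hMn : ∀ m, P {w | ∃ t ∈ M m, ∀ i, t i ∈ η w} = 0 := by
    intro m
    have hlim := (tendsto_measure_cthickening_of_isCompact (μ := volume) (hMk m)).comp hdec
    rw [measure_mono_null (fun t ht => ht.1) h0] at hlim
    refine le_antisymm (ge_of_tendsto hlim ?_) zero_le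
    filter_upwards [hdec.eventually_lt_const (show (0 : ℝ) < 1 / (m + 1) by positivity)] with n hn
    exact hη.measure_tuple_le (fun t ht => ht.2.2) hn
  have : ∀ᵐ w ∂P, ∀ m : ℕ, ¬ ∃ t ∈ M m, ∀ i, t i ∈ η w := by
    rw [ae_all_iff]
    intro m
    rw [ae_iff]
    simpa using hMn m
  filter_upwards [this] with w hw t hinj ht htN
  have h1 : ∀ᶠ m : ℕ in Filter.atTop, ‖t‖ ≤ m :=
    tendsto_natCast_atTop_atTop.eventually_ge_atTop ‖t‖
  have h2 : ∀ᶠ m : ℕ in Filter.atTop, ∀ i j, i ≠ j → 1 / ((m : ℝ) + 1) ≤ dist (t i) (t j) := by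
    simp only [Filter.eventually_all]
    intro i j hij
    exact tendsto_one_div_add_atTop_nhds_zero_nat.eventually_le_const
      (dist_pos.2 fun e => hij (hinj e))
  obtain ⟨m, hm1, hm2⟩ := (h1.and h2).exists
  exact hw m ⟨t, ⟨htN, hm1, hm2⟩, ht⟩

lemma volume_eq_zero_of_fibres {k : ℕ} {N : Set (Fin (k + 1) → Plane)} (hN : MeasurableSet N)
    (h : ∀ f : Fin k → Plane, volume {x : Plane | (Fin.cons x f : Fin (k + 1) → Plane) ∈ N} = 0) :
    volume N = 0 := by
  have mp := (volume_preserving_piFinSuccAbove (fun _ : Fin (k + 1) => Plane) 0).symm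
  rw [← mp.measure_preimage hN.nullMeasurableSet, Measure.volume_eq_prod,
    Measure.prod_apply_symm (mp.measurable hN)]
  refine (lintegral_congr fun f => ?_).trans lintegral_zero
  rw [← h f]
  congr 1
  ext x
  simp [MeasurableEquiv.piFinSuccAbove, Fin.insertNthEquiv]

lemma volume_coord_eq (i : Fin 2) (c : ℝ) : volume {x : Plane | x i = c} = 0 := by
  have mp := EuclideanSpace.volume_preserving_symm_measurableEquiv_toLp (Fin 2)
  have hs : MeasurableSet {f : Fin 2 → ℝ | f i = c} :=
    measurableSet_eq_fun (by fun_prop) (by fun_prop)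
  have h := mp.measure_preimage hs.nullMeasurableSet
  have h2 : volume {f : Fin 2 → ℝ | f i = c} = 0 :=
    Measure.pi_hyperplane (fun _ : Fin 2 => (volume : Measure ℝ)) i c
  rw [h2] at h
  exact h

lemma IsPoissonProcess.ae_coord_ne (hη : IsPoissonProcess P η) :
    ∀ᵐ w ∂P, ∀ i, ∀ a ∈ η w, ∀ b ∈ η w, a ≠ b → a i ≠ b i := by
  rw [ae_all_iff]
  intro i
  have hcl : IsClosed {t : Fin 2 → Plane | t 0 i = t 1 i} := isClosed_eq (by fun_prop) (by fun_prop)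
  have := hη.ae_notMem hcl (volume_eq_zero_of_fibres hcl.measurableSet fun f => by
    have := volume_coord_eq i (f 0 i)
    simpa using this)
  filter_upwards [this] with w hw a ha b hb hab
  refine hw ![a, b] ?_ ?_
  · intro i j; fin_cases i <;> fin_cases j <;> simp [hab, hab.symm]
  · intro i; fin_cases i <;> simp [ha, hb]

/-- Almost surely no tuple of distinct points of the process is equidistant from a point of a
compact set `C`, provided that all but one of the points determine this point. -/
theorem IsPoissonProcess.ae_not_equidistant (hη : IsPoissonProcess P η) {C : Set Plane}
    (hC : IsCompact C) {k : ℕ} {Φ : Set (Fin (k + 1) → Plane)} (hΦ : IsClosed Φ)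
    (huniq : ∀ f ∈ Φ, ∀ p ∈ C, ∀ q ∈ C, (∀ i, ‖f i - p‖ = ‖f 0 - p‖) →
      (∀ i, ‖f i - q‖ = ‖f 0 - q‖) → p = q) :
    ∀ᵐ w ∂P, ∀ x ∈ η w, ∀ f : Fin (k + 1) → Plane, Function.Injective f → (∀ i, f i ∈ η w) →
      (∀ i, x ≠ f i) → f ∈ Φ → ∀ p ∈ C, (∀ i, ‖x - p‖ = ‖f i - p‖) → False := by
  set N : Set (Fin (k + 2) → Plane) :=
    {t | Fin.tail t ∈ Φ ∧ ∃ p ∈ C, ∀ i : Fin (k + 1), ‖t 0 - p‖ = ‖t i.succ - p‖} with hN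
  -- A projection along the compact set `C` is closed.
  have hNc : IsClosed N := by
    have : CompactSpace C := isCompact_iff_compactSpace.1 hC
    have h1 : IsClosed {z : C × (Fin (k + 2) → Plane) |
        ∀ i : Fin (k + 1), ‖z.2 0 - z.1.1‖ = ‖z.2 i.succ - z.1.1‖} := by
      simp only [Set.ofPred_forall]
      exact isClosed_iInter fun i => isClosed_eq (by fun_prop) (by fun_prop)
    have h2 : N = Fin.tail ⁻¹' Φ ∩ Prod.snd '' {z : C × (Fin (k + 2) → Plane) |
        ∀ i : Fin (k + 1), ‖z.2 0 - z.1.1‖ = ‖z.2 i.succ - z.1.1‖} := by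
      ext t; simp [hN]
    rw [h2]
    exact (hΦ.preimage (by unfold Fin.tail; fun_prop)).inter
      (isClosedMap_snd_of_compactSpace _ h1)
  have hN0 : volume N = 0 := by
    refine volume_eq_zero_of_fibres hNc.measurableSet fun f => ?_
    rcases Set.eq_empty_or_nonempty {x : Plane | (Fin.cons x f : Fin (k + 2) → Plane) ∈ N}
      with he | ⟨x, hxΦ, p, hp, hx⟩
    · rw [he, measure_empty]
    -- The remaining points determine the centre `p`, so `x` is confined to a single circle.
    · refine measure_mono_null (fun y hy => ?_) (Measure.addHaar_sphere volume p ‖f 0 - p‖)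
      obtain ⟨_, q, hq, hy⟩ := hy
      simp only [Fin.cons_zero, Fin.cons_succ] at hx hy
      have : p = q := huniq f (by simpa using hxΦ) p hp q hq
        (fun i => (hx i).symm.trans (hx 0)) (fun i => (hy i).symm.trans (hy 0))
      subst this
      simpa [dist_eq_norm] using hy 0
  filter_upwards [hη.ae_notMem hNc hN0] with w hw x hx f hf hfη hxf hfΦ p hp he
  refine hw (Fin.cons x f) ?_ ?_ ⟨by simpa using hfΦ, p, hp, by simpa using he⟩
  · rw [Fin.cons_injective_iff]
    exact ⟨fun ⟨i, hi⟩ => hxf i hi.symm, hf⟩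
  · exact Fin.cases hx hfη

lemma exists_one_div_le {a : ℝ} (ha : a ≠ 0) : ∃ m : ℕ, 1 / ((m : ℝ) + 1) ≤ |a| := by
  obtain ⟨m, hm⟩ := exists_nat_one_div_lt (abs_pos.2 ha)
  exact ⟨m, hm.le⟩

lemma ne_zero_of_one_div_le {a : ℝ} {m : ℕ} (h : 1 / ((m : ℝ) + 1) ≤ |a|) : a ≠ 0 := by
  rintro rfl
  rw [abs_zero] at h
  exact absurd h (not_le.2 (by positivity))

lemma IsPoissonProcess.ae_four (hη : IsPoissonProcess P η) (x₀ x₁ y₀ y₁ : ℝ) :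
    ∀ᵐ w ∂P, ∀ p ∈ rect x₀ x₁ y₀ y₁, ∀ a ∈ η w, ∀ b ∈ η w, ∀ c ∈ η w, ∀ d ∈ η w,
    a ≠ b → a ≠ c → a ≠ d → b ≠ c → b ≠ d → c ≠ d →
    ‖a - p‖ = ‖b - p‖ → ‖a - p‖ = ‖c - p‖ → ‖a - p‖ = ‖d - p‖ → False := by
  -- Three non-collinear points determine their circumcentre. Non-collinearity is an open condition,
  -- so it is exhausted by the closed conditions with bound `1 / (m + 1)`.
  have key : ∀ m : ℕ, _ := fun m => hη.ae_not_equidistant (isCompact_rect x₀ x₁ y₀ y₁) (k := 2)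
    (Φ := {f | 1 / ((m : ℝ) + 1) ≤ |(f 2 0 - f 0 0) * (f 1 1 - f 0 1) -
      (f 2 1 - f 0 1) * (f 1 0 - f 0 0)|})
    (isClosed_le (by fun_prop) (by fun_prop)) (by
      intro f hf p _ q _ h1 h2
      have hD := ne_zero_of_one_div_le hf
      have a1 := (norm_sub_eq_iff _ _ _).1 (h1 1)
      have a2 := (norm_sub_eq_iff _ _ _).1 (h1 2)
      have b1 := (norm_sub_eq_iff _ _ _).1 (h2 1)
      have b2 := (norm_sub_eq_iff _ _ _).1 (h2 2)
      have c1 : (f 1 0 - f 0 0) * (p 0 - q 0) + (f 1 1 - f 0 1) * (p 1 - q 1) = 0 := by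
        linear_combination (b1 - a1) / 2
      have c2 : (f 2 0 - f 0 0) * (p 0 - q 0) + (f 2 1 - f 0 1) * (p 1 - q 1) = 0 := by
        linear_combination (b2 - a2) / 2
      ext i
      refine sub_eq_zero.1 (mul_left_cancel₀ hD ?_)
      fin_cases i
      · simp only [Fin.zero_eta]
        linear_combination (f 1 1 - f 0 1) * c2 - (f 2 1 - f 0 1) * c1
      · simp only [Fin.mk_one]
        linear_combination (f 2 0 - f 0 0) * c1 - (f 1 0 - f 0 0) * c2)
  filter_upwards [ae_all_iff.2 key] with w hw p hp a ha b hb c hc d hd hab hac had hbc hbd hcd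
    e1 e2 e3
  obtain ⟨m, hm⟩ := exists_one_div_le (cross_ne_zero hbc hbd hcd (e1.symm.trans e2)
    (e1.symm.trans e3))
  refine hw m a ha ![b, c, d] ?_ ?_ ?_ hm p hp ?_
  · intro i j
    fin_cases i <;> fin_cases j <;> simp [hbc, hbd, hcd, hbc.symm, hbd.symm, hcd.symm]
  all_goals intro i; fin_cases i
  exacts [hb, hc, hd, hab, hac, had, e1, e2, e3]

lemma IsPoissonProcess.ae_three (hη : IsPoissonProcess P η) (x₀ x₁ y₀ y₁ : ℝ) (i : Fin 2) (s : ℝ) :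
    ∀ᵐ w ∂P, ∀ p ∈ rect x₀ x₁ y₀ y₁, p i = s →
    ∀ a ∈ η w, ∀ b ∈ η w, ∀ c ∈ η w, a ≠ b → a ≠ c → b ≠ c →
    ‖a - p‖ = ‖b - p‖ → ‖a - p‖ = ‖c - p‖ → False := by
  have key : ∀ m : ℕ, _ := fun m => hη.ae_not_equidistant
    ((isCompact_rect x₀ x₁ y₀ y₁).inter_right (t := {p | p i = s})
      (isClosed_eq (f := fun p : Plane => p i) (by fun_prop) (by fun_prop))) (k := 1)
    -- In `Fin 2`, `1 - i` is the other coordinate. If the two points differ in it, their bisector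
    -- meets the line `p i = s` at most once.
    (Φ := {f | 1 / ((m : ℝ) + 1) ≤ |f 1 (1 - i) - f 0 (1 - i)|})
    (isClosed_le (by fun_prop) (by fun_prop)) (by
      intro f hf p hp q hq h1 h2
      have hD := ne_zero_of_one_div_le hf
      have a1 := (norm_sub_eq_iff _ _ _).1 (h1 1)
      have b1 := (norm_sub_eq_iff _ _ _).1 (h2 1)
      have c1 : (f 1 0 - f 0 0) * (p 0 - q 0) + (f 1 1 - f 0 1) * (p 1 - q 1) = 0 := by
        linear_combination (b1 - a1) / 2
      have hpq : p i - q i = 0 := sub_eq_zero.2 (hp.2.trans hq.2.symm)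
      have hpq' : p (1 - i) - q (1 - i) = 0 := by
        refine mul_left_cancel₀ hD ?_
        rw [mul_zero]
        fin_cases i
        · have hpq : p 0 - q 0 = 0 := hpq
          change (f 1 1 - f 0 1) * (p 1 - q 1) = 0
          rw [hpq] at c1; linarith
        · have hpq : p 1 - q 1 = 0 := hpq
          change (f 1 0 - f 0 0) * (p 0 - q 0) = 0
          rw [hpq] at c1; linarith
      ext j
      rw [← sub_eq_zero]
      fin_cases i <;> fin_cases j <;> assumption)
  filter_upwards [ae_all_iff.2 key, hη.ae_coord_ne] with w hw hco p hp hps a ha b hb c hc hab hac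
    hbc e1 e2
  obtain ⟨m, hm⟩ := exists_one_div_le (sub_ne_zero.2 (hco (1 - i) c hc b hb hbc.symm))
  refine hw m a ha ![b, c] ?_ ?_ ?_ hm p ⟨hp, hps⟩ ?_
  · intro i j
    fin_cases i <;> fin_cases j <;> simp [hbc, hbc.symm]
  all_goals intro i; fin_cases i
  exacts [hb, hc, hab, hac, e1, e2]

lemma IsPoissonProcess.ae_two (hη : IsPoissonProcess P η) (p : Plane) :
    ∀ᵐ w ∂P, ∀ a ∈ η w, ∀ b ∈ η w, a ≠ b → ‖a - p‖ = ‖b - p‖ → False := by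
  filter_upwards [hη.ae_not_equidistant (isCompact_singleton (x := p)) (k := 0) isClosed_univ
    (by rintro f - p rfl q rfl _ _; rfl)] with w hw a ha b hb hab e
  exact hw a ha (fun _ => b) (fun i j _ => Fin.ext (by omega)) (fun _ => hb) (fun _ => hab)
    trivial p rfl (fun _ => e)

/-- Almost surely a Poisson process is in general position with respect to a given rectangle. -/
theorem IsPoissonProcess.ae_generic (hη : IsPoissonProcess P η) (x₀ x₁ y₀ y₁ : ℝ) :
    ∀ᵐ w ∂P, Generic (η w) x₀ x₁ y₀ y₁ := by
  filter_upwards [hη.ae_locFinite, hη.ae_four x₀ x₁ y₀ y₁, hη.ae_three x₀ x₁ y₀ y₁ 0 x₀,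
    hη.ae_three x₀ x₁ y₀ y₁ 0 x₁, hη.ae_three x₀ x₁ y₀ y₁ 1 y₀, hη.ae_three x₀ x₁ y₀ y₁ 1 y₁,
    hη.ae_two !₂[x₀, y₀], hη.ae_two !₂[x₀, y₁], hη.ae_two !₂[x₁, y₀], hη.ae_two !₂[x₁, y₁],
    hη.ae_coord_ne] with w h1 h2 h3 h4 h5 h6 h7 h8 h9 h10 h11
  refine ⟨h1, h2, ?_, ?_, h11⟩
  · rintro p hp (hs | hs | hs | hs)
    exacts [h3 p hp hs, h4 p hp hs, h5 p hp hs, h6 p hp hs]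
  · have ep : ∀ {p : Plane} {a b : ℝ}, p 0 = a → p 1 = b → p = !₂[a, b] := by
      intro p a b ha hb
      ext i
      fin_cases i <;> simp [ha, hb]
    rintro p (ha | ha) (hb | hb) <;> rw [ep ha hb] <;> assumption

end Poisson

/-! ### Transfer to the random colouring -/

section Switching

variable {η : Set Plane} {x₀ x₁ y₀ y₁ : ℝ}

lemma measurable_restrictCol (η : Set Plane) (x₀ x₁ y₀ y₁ : ℝ) :
    Measurable (restrictCol η x₀ x₁ y₀ y₁) :=
  measurable_pi_lambda _ fun v => measurable_pi_apply v.1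

/-- Under the colouring law, the colours of the cells meeting the rectangle are uniform. -/
lemma integral_restrictCol [Fintype (CellsIn η x₀ x₁ y₀ y₁)]
    [DecidableEq (CellsIn η x₀ x₁ y₀ y₁)] (f : (CellsIn η x₀ x₁ y₀ y₁ → Bool) → ℝ) :
    ∫ ω, f (restrictCol η x₀ x₁ y₀ y₁ ω) ∂(colourLaw η) =
      (1 / 2) ^ Fintype.card (CellsIn η x₀ x₁ y₀ y₁) * ∑ ω, f ω := by
  have hmap : (colourLaw η).map (restrictCol η x₀ x₁ y₀ y₁) =
      Measure.pi fun _ => (PMF.uniformOfFintype Bool).toMeasure := by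
    rw [← Measure.infinitePi_eq_pi]
    exact Measure.infinitePi_map_restrict'
      (I := {u : η | (cell η u ∩ rect x₀ x₁ y₀ y₁).Nonempty})
      (fun _ : η => (PMF.uniformOfFintype Bool).toMeasure)
  rw [← integral_map (f := f) (measurable_restrictCol η x₀ x₁ y₀ y₁).aemeasurable
    (measurable_of_countable f).aestronglyMeasurable, hmap, integral_fintype .of_finite,
    Finset.mul_sum]
  refine Finset.sum_congr rfl fun ω _ => ?_
  rw [smul_eq_mul]
  congr 1
  rw [measureReal_def, Measure.pi_singleton]
  simp

lemma maxCrossings_eq (η : Set Plane) (x₀ x₁ y₀ y₁ : ℝ) (ω : Colouring η) :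
    maxCrossings η x₀ x₁ y₀ y₁ ω =
      (system η x₀ x₁ y₀ y₁).maxCount Set.univ (restrictCol η x₀ x₁ y₀ y₁ ω) := by
  rw [maxCrossings, crossingCounts_eq, CrossingSystem.maxCount]

/-- Colour switching for a point set in general position. -/
theorem Generic.redCrossing_eq (h : Generic η x₀ x₁ y₀ y₁) (hx : x₀ < x₁) (hy : y₀ < y₁) :
    MeasurableSet (redCrossing η x₀ x₁ y₀ y₁) ∧ Measurable (maxCrossings η x₀ x₁ y₀ y₁) ∧
      (∀ ω : Colouring η,
        IsGreatest (crossingCounts η ω x₀ x₁ y₀ y₁) (maxCrossings η x₀ x₁ y₀ y₁ ω)) ∧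
      (colourLaw η).real (redCrossing η x₀ x₁ y₀ y₁) =
        ∫ ω, (2 : ℝ) ^ (-(maxCrossings η x₀ x₁ y₀ y₁ ω : ℤ)) ∂(colourLaw η) := by
  classical
  have := h.finite_cellsIn (x₀ := x₀) (x₁ := x₁) (y₀ := y₀) (y₁ := y₁)
  have := Fintype.ofFinite (CellsIn η x₀ x₁ y₀ y₁)
  set G := system η x₀ x₁ y₀ y₁ with hG
  set res := restrictCol η x₀ x₁ y₀ y₁ with hres
  have hGl : G.Lawful := h.lawful hx hy
  have hresm : Measurable res := measurable_restrictCol η x₀ x₁ y₀ y₁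
  have hred : redCrossing η x₀ x₁ y₀ y₁ = res ⁻¹' {ω | G.NoCol Set.univ false ω} := by
    ext ω; exact h.mem_redCrossing_iff hx hy ω
  have hredm : MeasurableSet (redCrossing η x₀ x₁ y₀ y₁) := by
    rw [hred]; exact hresm (Set.to_countable _).measurableSet
  have hmax : maxCrossings η x₀ x₁ y₀ y₁ = fun ω => G.maxCount Set.univ (res ω) := by
    ext ω; exact maxCrossings_eq η x₀ x₁ y₀ y₁ ω
  refine ⟨hredm, ?_, fun ω => ?_, ?_⟩
  · rw [hmax]
    exact (measurable_of_countable (G.maxCount Set.univ)).comp hresm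
  · rw [crossingCounts_eq, maxCrossings_eq]
    exact hGl.isGreatest _ _
  · have h1 : ∀ ω, (redCrossing η x₀ x₁ y₀ y₁).indicator (1 : Colouring η → ℝ) ω =
        G.noColInd Set.univ false (res ω) := by
      intro ω
      rw [hred, Set.indicator_apply, CrossingSystem.noColInd]
      rfl
    rw [← integral_indicator_one hredm, integral_congr_ae (.of_forall h1), hmax,
      integral_restrictCol]
    have h2 : ∀ ω, (2 : ℝ) ^ (-(G.maxCount Set.univ (res ω) : ℤ)) =
        (1 / 2) ^ G.maxCount Set.univ (res ω) := by
      intro ω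
      rw [zpow_neg, zpow_natCast, one_div, inv_pow]
    simp only [h2]
    rw [integral_restrictCol (f := fun ω => (1 / 2 : ℝ) ^ G.maxCount Set.univ ω)]
    -- Colour switching over all cells with constant weight; `false` is blue, the colour whose
    -- vertical crossings prevent a red horizontal one.
    have := hGl.sum_noCol false _ Set.univ le_rfl (fun _ => 1) (fun _ _ _ => rfl)
    simp only [one_mul] at this
    rw [this]

end Switching

end Voronoi

theorem mainTheorem9 {Ω : Type*} [MeasurableSpace Ω] (P : Measure Ω) [IsProbabilityMeasure P]
    (η : Ω → Set Voronoi.Plane) (hη : Voronoi.IsPoissonProcess P η)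
    (x₀ x₁ y₀ y₁ : ℝ) (hx : x₀ < x₁) (hy : y₀ < y₁) :
    ∀ᵐ w ∂P,
      MeasurableSet (Voronoi.redCrossing (η w) x₀ x₁ y₀ y₁) ∧
      Measurable (Voronoi.maxCrossings (η w) x₀ x₁ y₀ y₁) ∧
      (∀ ω : Voronoi.Colouring (η w),
        IsGreatest (Voronoi.crossingCounts (η w) ω x₀ x₁ y₀ y₁)
          (Voronoi.maxCrossings (η w) x₀ x₁ y₀ y₁ ω)) ∧
      (Voronoi.colourLaw (η w)).real (Voronoi.redCrossing (η w) x₀ x₁ y₀ y₁) =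
        ∫ ω, (2 : ℝ) ^ (-(Voronoi.maxCrossings (η w) x₀ x₁ y₀ y₁ ω : ℤ))
          ∂(Voronoi.colourLaw (η w)) := by
  filter_upwards [hη.ae_generic x₀ x₁ y₀ y₁] with w hw
  exact hw.redCrossing_eq hx hy
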